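/- **Setting.** Let $f,g:\mathbb R^m\times\mathbb R^n\to\mathbb R$ be differentiable, with $\nabla_1 g(x,\cdot)$ and $\nabla_2 g(x,\cdot)$ differentiable for every $x$ (Jacobians $\nabla^2_{12}g$, $\nabla^2_{22}g$), and let $\mu>0$, $L_{f,1},L_{g,1},L_{g,2}>0$, $L_{f,0},C_{f,0}\ge 0$ be such that: $g(x,\cdot)$ is $\mu$-strongly convex for every $x$, where $\mu\le L_{g,1}$ (automatic if $n\ge1$); $\nabla g$ is $L_{g,1}$-Lipschitz; $\nabla^2_{22}g$ and $\nabla^2_{12}g$ are $L_{g,2}$-Lipschitz; $\nabla f$ is $L_{f,1}$-Lipschitz; $\|\nabla_2 f(x,y^*(x))\|\le L_{f,0}$ for all $x$, where $y^*(x)=\arg\min_y g(x,y)$; and $\|\nabla_1 f(x,y)\|\le C_{f,0}$ for all $x,y$. Put $\Phi(x)=f(x,y^*(x))$, assume $\Phi^*=\inf\Phi>-\infty$, and put $u^*(x)=[\nabla^2_{22}g(x,y^*(x))]^{-1}\nabla_2 f(x,y^*(x))$, $\kappa=\max\{L_{g,1},L_{f,1}\}/\mu$, $L_1=L_{f,1}+L_{g,2}L_{f,0}/\mu$.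 **NBO-CG.** From $(x^0,y^0,u^0)$, with step size $\alpha$, for $k=0,1,\dots$: let $v^k$ and $w^k$ be the results of $T+1$ conjugate gradient iterations (stopped earlier if the residual vanishes), started at $0$, for $$\min_v \tfrac12\langle H_kv,v\rangle-\langle\nabla_2g(x^k,y^k),v\rangle,\qquad \min_w \tfrac12\langle H_kw,w\rangle-\langle H_ku^k-\nabla_2f(x^k,y^k),w\rangle,\qquad H_k=\nabla_{22}^2g(x^k,y^k);$$ set $y^{k+1}=y^k-v^k$, $u^{k+1}=u^k-w^k$ and $x^{k+1}=x^k-\alpha\big(\nabla_1f(x^k,y^k)-\nabla^2_{12}g(x^k,y^k)u^k\big)$. **Admissible initial points.** $(x^0,y^0,u^0)$ is admissible if $\|y^0-y^*(x^0)\|\le\min\{\frac{\mu}{2L_{g,2}},\frac1{2\sqrt{L_1}}\}$ and $\|u^0-u^*(x^0)\|\le\min\{\frac{5L_1}{2L_{g,2}},\frac{\sqrt{L_1}}{\mu}\}$. **Initialization.** Given $x^0,y^{0,0},u^{0,0}$ and a step size $0<\beta\le 1/L_{g,1}$, take $N_0$ gradient steps $y\leftarrow y-\beta\nabla_2g(x^0,y)$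 from $y^{0,0}$ to get $y^0$, then $Q_0$ steps $u\leftarrow u-\beta(\nabla_{22}^2g(x^0,y^0)u-\nabla_2f(x^0,y^0))$ from $u^{0,0}$ to get $u^0$. **Claim.** There are constants $a,\tau>0$ depending only on $L_{f,1},L_{g,1},L_{g,2},L_{f,0},C_{f,0}$ and, for all $D,R$ and $\beta\in(0,1/L_{g,1}]$, a constant $C>0$ depending only on these, $D$, $R$ and $\beta$ (neither on $\mu$, nor on $m,n,f,g$ or the initial point), such that for $\alpha=a\kappa^{-3}$ and $T=\lceil\tau\sqrt\kappa\,(1+\log\kappa)\rceil$ the following holds. $\Phi$ is differentiable, and: 1. (Rate.) From every admissible initial point and for every $K\ge1$, $$\min_{0\le k\le K-1}\|\nabla\Phi(x^k)\|^2\le\frac{2\Phi(x^0)-2\Phi^*+4}{\alpha K},$$ and the right-hand side may be replaced by $C\kappa^3/K$ if $\Phi(x^0)-\Phi^*\le D$. 2. (Complexity.) For every $\varepsilon\in(0,1]$ and every admissible initial point with $\Phi(x^0)-\Phi^*\le D$, some number $K\le C\kappa^3/\varepsilon$ of outer iterations achieves $\min_{0\le k\le K-1}\|\nabla\Phi(x^k)\|^2\le\varepsilon$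 with at most $C\kappa^3/\varepsilon$ gradient computations, at most $C\kappa^3/\varepsilon$ Jacobian-vector products, and at most $C\kappa^{3.5}(1+\log\kappa)/\varepsilon$ Hessian-vector products. 3. (Initialization included.) There are $N_0,Q_0\le C\kappa(1+\log\kappa)$, depending on $\mu$ and the constants only, such that whenever $\|\nabla_2g(x^0,y^{0,0})\|\le R$ and $\|u^{0,0}\|\le R$ the initialization yields an admissible point; if moreover $\Phi(x^0)-\Phi^*\le D$, the bounds of item 2 also hold for the total cost of the initialization and the NBO-CG iterations started at that point. -/

import Mathlib

open Set

noncomputable section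

namespace Bilevel

/-- `ℝ^d` with the Euclidean norm. -/
abbrev Vec (d : ℕ) : Type := EuclideanSpace ℝ (Fin d)

/-- `ℝ^m × ℝ^n` with the Euclidean norm `‖(x, y)‖² = ‖x‖² + ‖y‖²`. -/
abbrev Joint (m n : ℕ) : Type := WithLp 2 (Vec m × Vec n)

/-- The point `(x, y)`. -/
abbrev pt {m n : ℕ} (x : Vec m) (y : Vec n) : Joint m n := WithLp.toLp 2 (x, y)

/-! ### Derivatives -/

/-- `∇₁ h(x, y)`. -/
def grad1 {m n : ℕ} (h : Joint m n → ℝ) (x : Vec m) (y : Vec n) : Vec m :=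
  (gradient h (pt x y)).fst

/-- `∇₂ h(x, y)`. -/
def grad2 {m n : ℕ} (h : Joint m n → ℝ) (x : Vec m) (y : Vec n) : Vec n :=
  (gradient h (pt x y)).snd

/-- `∇²₁₂ h(x, y)`: the Jacobian of `y ↦ ∇₁ h(x, y)`. -/
def jac12 {m n : ℕ} (h : Joint m n → ℝ) (x : Vec m) (y : Vec n) : Vec n →L[ℝ] Vec m :=
  fderiv ℝ (fun y' => grad1 h x y') y

/-- `∇²₂₂ h(x, y)`: the Hessian of `h(x, ·)`, i.e. the Jacobian of `y ↦ ∇₂ h(x, y)`. -/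
def hess22 {m n : ℕ} (h : Joint m n → ℝ) (x : Vec m) (y : Vec n) : Vec n →L[ℝ] Vec n :=
  fderiv ℝ (fun y' => grad2 h x y') y

/-! ### The bilevel problem `min_x f(x, y*(x))`, `y*(x) = argmin_y g(x, y)` -/

/-- `y*(x)`, the minimizer of `g(x, ·)`. -/
def yStar {m n : ℕ} (g : Joint m n → ℝ) (x : Vec m) : Vec n :=
  Classical.epsilon (fun y => ∀ z, g (pt x y) ≤ g (pt x z))

/-- `u*(x) = [∇²₂₂ g(x, y*(x))]⁻¹ ∇₂ f(x, y*(x))`. -/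
def uStar {m n : ℕ} (f g : Joint m n → ℝ) (x : Vec m) : Vec n :=
  (hess22 g x (yStar g x)).inverse (grad2 f x (yStar g x))

/-- The objective `Φ(x) = f(x, y*(x))`. -/
def Phi {m n : ℕ} (f g : Joint m n → ℝ) (x : Vec m) : ℝ := f (pt x (yStar g x))

/-- The optimal value `Φ* = inf_x Φ(x)`. -/
def PhiStar {m n : ℕ} (f g : Joint m n → ℝ) : ℝ := ⨅ x, Phi f g x

/-- The standing assumptions on `f` and `g`. Matrices are measured in the operator norm, which is
at most the Frobenius norm. -/
structure Assumptions {m n : ℕ} (f g : Joint m n → ℝ) (μ Lf1 Lg1 Lg2 Lf0 Cf0 : ℝ) : Prop where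
  f_diff : Differentiable ℝ f
  g_diff : Differentiable ℝ g
  g_diff2 : ∀ x, Differentiable ℝ (fun y => gradient g (pt x y))
  g_strong : ∀ x, StrongConvexOn univ μ (fun y => g (pt x y))
  g_grad_lip : ∀ p q, ‖gradient g p - gradient g q‖ ≤ Lg1 * ‖p - q‖
  g_hess_lip : ∀ x y x' y', ‖hess22 g x y - hess22 g x' y'‖ ≤ Lg2 * ‖pt x y - pt x' y'‖
  g_jac_lip : ∀ x y x' y', ‖jac12 g x y - jac12 g x' y'‖ ≤ Lg2 * ‖pt x y - pt x' y'‖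
  f_grad_lip : ∀ p q, ‖gradient f p - gradient f q‖ ≤ Lf1 * ‖p - q‖
  f_grad2_bound : ∀ x, ‖grad2 f x (yStar g x)‖ ≤ Lf0
  f_grad1_bound : ∀ x y, ‖grad1 f x y‖ ≤ Cf0

/-! ### Computations that count their oracle calls -/

/-- Numbers of gradient computations, Jacobian-vector products and Hessian-vector products. -/
structure Cost where
  grad : ℕ
  jac : ℕ
  hess : ℕ

/-- A computed value together with the number of oracle calls spent on it. -/
structure Counted (A : Type) where
  val : A
  cost : Cost

instance : Monad Counted where
  pure a := ⟨a, ⟨0, 0, 0⟩⟩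
  bind c k :=
    ⟨(k c.val).val,
      ⟨c.cost.grad + (k c.val).cost.grad, c.cost.jac + (k c.val).cost.jac,
        c.cost.hess + (k c.val).cost.hess⟩⟩

/-- Oracle for `∇₁ h(x, y)`: one gradient computation. -/
def askGrad1 {m n : ℕ} (h : Joint m n → ℝ) (x : Vec m) (y : Vec n) : Counted (Vec m) :=
  ⟨grad1 h x y, ⟨1, 0, 0⟩⟩

/-- Oracle for `∇₂ h(x, y)`: one gradient computation. -/
def askGrad2 {m n : ℕ} (h : Joint m n → ℝ) (x : Vec m) (y : Vec n) : Counted (Vec n) :=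
  ⟨grad2 h x y, ⟨1, 0, 0⟩⟩

/-- Oracle for `∇²₁₂ h(x, y) u`: one Jacobian-vector product. -/
def askJac {m n : ℕ} (h : Joint m n → ℝ) (x : Vec m) (y u : Vec n) : Counted (Vec m) :=
  ⟨jac12 h x y u, ⟨0, 1, 0⟩⟩

/-- Oracle for `∇²₂₂ h(x, y) u`: one Hessian-vector product. -/
def askHess {m n : ℕ} (h : Joint m n → ℝ) (x : Vec m) (y u : Vec n) : Counted (Vec n) :=
  ⟨hess22 h x y u, ⟨0, 0, 1⟩⟩

/-! ### Conjugate gradient -/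

/-- Current solution `v`, residual `r = b - H v` and search direction `p`. -/
structure CGState (n : ℕ) where
  sol : Vec n
  res : Vec n
  dir : Vec n

open Classical in
/-- One iteration of the conjugate gradient method for `H v = b`; it stops once the residual
vanishes. -/
def cgStep {n : ℕ} (H : Vec n → Counted (Vec n)) (s : CGState n) : Counted (CGState n) :=
  if s.res = 0 then pure s
  else do
    let q ← H s.dir
    let a : ℝ := ‖s.res‖ ^ 2 / inner ℝ s.dir q
    let r : Vec n := s.res - a • q
    let b : ℝ := ‖r‖ ^ 2 / ‖s.res‖ ^ 2
    pure ⟨s.sol + a • s.dir, r, r + b • s.dir⟩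

/-- `N` iterations of conjugate gradient. -/
def cgIter {n : ℕ} (H : Vec n → Counted (Vec n)) (s : CGState n) : ℕ → Counted (CGState n)
  | 0 => pure s
  | N + 1 => do
    let s' ← cgIter H s N
    cgStep H s'

/-- Conjugate gradient for `min_v ½⟨H v, v⟩ - ⟨b, v⟩`: starting from `v^{-1} = 0` it computes
`v^0, …, v^T` (thus `T + 1` iterations) and returns `v^T`. -/
def cg {n : ℕ} (H : Vec n → Counted (Vec n)) (b : Vec n) (T : ℕ) : Counted (Vec n) := do
  let s ← cgIter H ⟨0, b, b⟩ (T + 1)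
  pure s.sol

/-! ### NBO-CG -/

/-- An iterate `(x^k, y^k, u^k)`. -/
structure Iterate (m n : ℕ) where
  x : Vec m
  y : Vec n
  u : Vec n

/-- One outer iteration of NBO-CG with step size `α`. -/
def nboStep {m n : ℕ} (f g : Joint m n → ℝ) (α : ℝ) (T : ℕ) (s : Iterate m n) :
    Counted (Iterate m n) := do
  let dy ← askGrad2 g s.x s.y
  let Hu ← askHess g s.x s.y s.u
  let f2 ← askGrad2 f s.x s.y
  let v ← cg (askHess g s.x s.y) dy T
  let w ← cg (askHess g s.x s.y) (Hu - f2) T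
  let f1 ← askGrad1 f s.x s.y
  let Ju ← askJac g s.x s.y s.u
  pure ⟨s.x - α • (f1 - Ju), s.y - v, s.u - w⟩

/-- The iterate `(x^k, y^k, u^k)` of NBO-CG started at `s`, with the cost of the first `k` outer
iterations. -/
def nboCG {m n : ℕ} (f g : Joint m n → ℝ) (α : ℝ) (T : ℕ) (s : Iterate m n) :
    ℕ → Counted (Iterate m n)
  | 0 => pure s
  | k + 1 => do
    let s' ← nboCG f g α T s k
    nboStep f g α T s'

/-! ### Initialization -/

/-- The set of admissible initial points `(x⁰, y⁰, u⁰)`, with `L₁ = L_{f,1} + L_{g,2} L_{f,0} / μ`. -/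
def box {m n : ℕ} (f g : Joint m n → ℝ) (μ Lf1 Lg2 Lf0 : ℝ) : Set (Iterate m n) :=
  {s | ‖s.y - yStar g s.x‖ ≤ min (μ / (2 * Lg2)) (1 / (2 * √(Lf1 + Lg2 * (Lf0 / μ)))) ∧
    ‖s.u - uStar f g s.x‖ ≤
      min (5 * (Lf1 + Lg2 * (Lf0 / μ)) / (2 * Lg2)) (√(Lf1 + Lg2 * (Lf0 / μ)) / μ)}

/-- `N` gradient descent steps on `g(x, ·)` with step size `β`. -/
def initY {m n : ℕ} (g : Joint m n → ℝ) (β : ℝ) (x : Vec m) (y : Vec n) : ℕ → Counted (Vec n)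
  | 0 => pure y
  | N + 1 => do
    let y' ← initY g β x y N
    let d ← askGrad2 g x y'
    pure (y' - β • d)

/-- `Q` gradient descent steps with step size `β` on `½⟨∇²₂₂ g(x, y) u, u⟩ - ⟨b, u⟩`. -/
def initU {m n : ℕ} (g : Joint m n → ℝ) (β : ℝ) (x : Vec m) (y b u : Vec n) :
    ℕ → Counted (Vec n)
  | 0 => pure u
  | Q + 1 => do
    let u' ← initU g β x y b u Q
    let Hu ← askHess g x y u'
    pure (u' - β • (Hu - b))

/-- The initialization procedure: gradient descent for `y⁰`, then for `u⁰`. -/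
def initBox {m n : ℕ} (f g : Joint m n → ℝ) (β : ℝ) (N Q : ℕ) (s : Iterate m n) :
    Counted (Iterate m n) := do
  let y ← initY g β s.x s.y N
  let b ← askGrad2 f s.x y
  let u ← initU g β s.x y b s.u Q
  pure ⟨s.x, y, u⟩

/-- The complete method: initialization followed by `K` outer iterations of NBO-CG. -/
def fullNboCG {m n : ℕ} (f g : Joint m n → ℝ) (β : ℝ) (N Q : ℕ) (α : ℝ) (T : ℕ)
    (s : Iterate m n) (K : ℕ) : Counted (Iterate m n) := do
  let s0 ← initBox f g β N Q s
  nboCG f g α T s0 K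

/-- `min_{0 ≤ k ≤ K-1} ‖∇Φ(x^k)‖² ≤ B` for the NBO-CG iterates started at `s`. -/
def minGradLE {m n : ℕ} (f g : Joint m n → ℝ) (α : ℝ) (T : ℕ) (s : Iterate m n) (K : ℕ)
    (B : ℝ) : Prop :=
  ∃ k < K, ‖gradient (Phi f g) (nboCG f g α T s k).val.x‖ ^ 2 ≤ B

end Bilevel

end

/-! The conjugate gradient iterates minimize over Krylov spaces, so Chebyshev polynomials bound
their error: about `√κ (1 + log κ)` iterations make it a fixed small fraction of the initial one. In
the box of admissible points the Newton step on `y` then contracts `‖y - y*(x)‖` by quadratic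
convergence, and the step on `u` contracts `‖u - u*(x)‖` up to a multiple of `‖y - y*(x)‖`. With
`α` of order `κ⁻³` the step on `x` moves `y*(x)` and `u*(x)` too little to leave the box, and it is
a gradient step for `Φ` with an error controlled by these two distances. Adding a suitable multiple
of their squares to `Φ` gives a Lyapunov function that decreases by at least `α ‖∇Φ‖² / 2` per
iteration, and telescoping yields the rate. -/

open Set

noncomputable section

namespace Bilevel

open scoped InnerProductSpace

/-! ### Coercive and symmetric operators -/

section Operators

variable {V : Type*} [NormedAddCommGroup V] [InnerProductSpace ℝ V]

theorem mul_norm_le_norm_of_mul_norm_sq_le_inner {c : ℝ} {v w : V}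
    (h : c * ‖v‖ ^ 2 ≤ ⟪w, v⟫_ℝ) : c * ‖v‖ ≤ ‖w‖ := by
  rcases eq_or_ne v 0 with rfl | hv
  · simp
  · refine le_of_mul_le_mul_right ?_ (norm_pos_iff.2 hv)
    calc c * ‖v‖ * ‖v‖ = c * ‖v‖ ^ 2 := by ring
      _ ≤ ‖w‖ * ‖v‖ := h.trans (real_inner_le_norm w v)

theorem isInvertible_of_coercive [CompleteSpace V] {H : V →L[ℝ] V} {μ : ℝ} (hμ0 : 0 < μ)
    (hμ : ∀ v, μ * ‖v‖ ^ 2 ≤ ⟪H v, v⟫_ℝ) : H.IsInvertible := by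
  have hcoercive : IsCoercive (innerSL ℝ ∘L H) :=
    ⟨μ, hμ0, fun v => by rw [mul_assoc, ← pow_two]; exact hμ v⟩
  refine ⟨hcoercive.continuousLinearEquivOfBilin, ContinuousLinearMap.ext fun v => ?_⟩
  exact ext_inner_right ℝ fun w => hcoercive.continuousLinearEquivOfBilin_apply v w

theorem inner_map_le_inner_map_of_inner_map_sub_eq_zero {H : V →ₗ[ℝ] V} (hs : H.IsSymmetric)
    (hpos : ∀ v, 0 ≤ ⟪H v, v⟫_ℝ) {d e : V} (h : ⟪H e, d - e⟫_ℝ = 0) :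
    ⟪H e, e⟫_ℝ ≤ ⟪H d, d⟫_ℝ := by
  have h' : ⟪H (d - e), e⟫_ℝ = 0 := by rw [hs, real_inner_comm, h]
  have hsplit : ⟪H d, d⟫_ℝ = ⟪H e, e⟫_ℝ + ⟪H (d - e), d - e⟫_ℝ := by
    obtain ⟨z, rfl⟩ : ∃ z, d = e + z := ⟨d - e, by abel⟩
    rw [add_sub_cancel_left] at h h' ⊢
    rw [map_add, inner_add_left, inner_add_right, inner_add_right, h, h']
    ring
  linarith [hpos (d - e)]

section Polynomial

open Polynomial

theorem isSymmetric_aeval {H : V →ₗ[ℝ] V} (hs : H.IsSymmetric) (p : ℝ[X]) :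
    (aeval H p).IsSymmetric := by
  induction p using Polynomial.induction_on' with
  | add p q hp hq => simpa only [map_add] using hp.add hq
  | monomial k c =>
    rw [aeval_monomial, ← Algebra.smul_def]
    exact (hs.pow k).smul (RCLike.conj_to_real)

variable [FiniteDimensional ℝ V] {H : V →ₗ[ℝ] V} (hs : H.IsSymmetric)
include hs

theorem eigenvalues_mem_Icc {μ M : ℝ} (hμ : ∀ v, μ * ‖v‖ ^ 2 ≤ ⟪H v, v⟫_ℝ)
    (hM : ∀ v, ⟪H v, v⟫_ℝ ≤ M * ‖v‖ ^ 2) (i : Fin (Module.finrank ℝ V)) :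
    hs.eigenvalues rfl i ∈ Icc μ M := by
  have hb : ⟪H (hs.eigenvectorBasis rfl i), hs.eigenvectorBasis rfl i⟫_ℝ =
      hs.eigenvalues rfl i := by
    rw [hs.apply_eigenvectorBasis rfl i, real_inner_smul_left, real_inner_self_eq_norm_sq,
      OrthonormalBasis.norm_eq_one]
    simp
  have hlower := hμ (hs.eigenvectorBasis rfl i)
  have hupper := hM (hs.eigenvectorBasis rfl i)
  rw [hb, OrthonormalBasis.norm_eq_one] at hlower hupper
  constructor <;> linarith

theorem inner_eigenvectorBasis_aeval (p : ℝ[X]) (i : Fin (Module.finrank ℝ V)) (x : V) :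
    ⟪hs.eigenvectorBasis rfl i, aeval H p x⟫_ℝ =
      p.eval (hs.eigenvalues rfl i) * ⟪hs.eigenvectorBasis rfl i, x⟫_ℝ := by
  rw [← isSymmetric_aeval hs p,
    Module.End.aeval_apply_of_hasEigenvector (hs.hasEigenvector_eigenvectorBasis rfl i),
    real_inner_smul_left]
  rfl

theorem norm_aeval_apply_le {μ M ε : ℝ} (hμ : ∀ v, μ * ‖v‖ ^ 2 ≤ ⟪H v, v⟫_ℝ)
    (hM : ∀ v, ⟪H v, v⟫_ℝ ≤ M * ‖v‖ ^ 2) {p : ℝ[X]} (hp : ∀ t ∈ Icc μ M, |p.eval t| ≤ ε)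
    (x : V) : ‖aeval H p x‖ ≤ ε * ‖x‖ := by
  rcases eq_or_ne x 0 with rfl | hx
  · simp
  have hp' : ∀ i, |p.eval (hs.eigenvalues rfl i)| ≤ ε := fun i =>
    hp _ (eigenvalues_mem_Icc hs hμ hM i)
  have hε : 0 ≤ ε := by
    have : Nontrivial V := ⟨x, 0, hx⟩
    exact (abs_nonneg _).trans (hp' ⟨0, Module.finrank_pos⟩)
  refine le_of_sq_le_sq ?_ (by positivity)
  rw [mul_pow, ← (hs.eigenvectorBasis rfl).sum_sq_norm_inner_right,
    ← (hs.eigenvectorBasis rfl).sum_sq_norm_inner_right x, Finset.mul_sum]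
  refine Finset.sum_le_sum fun i _ => ?_
  rw [inner_eigenvectorBasis_aeval hs, norm_mul, mul_pow]
  gcongr
  exact hp' i

theorem norm_sub_smul_apply_le {μ M β : ℝ} (hμ : ∀ v, μ * ‖v‖ ^ 2 ≤ ⟪H v, v⟫_ℝ)
    (hM : ∀ v, ⟪H v, v⟫_ℝ ≤ M * ‖v‖ ^ 2) (hβ0 : 0 ≤ β) (hβ : β * M ≤ 1) (x : V) :
    ‖x - β • H x‖ ≤ (1 - β * μ) * ‖x‖ := by
  have habs : ∀ t ∈ Icc μ M, |(1 - C β * X : ℝ[X]).eval t| ≤ 1 - β * μ := by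
    rintro t ⟨hμt, htM⟩
    rw [eval_sub, eval_one, eval_mul, eval_C, eval_X, abs_of_nonneg]
    · linarith [mul_le_mul_of_nonneg_left hμt hβ0]
    · linarith [mul_le_mul_of_nonneg_left htM hβ0]
  simpa [Module.algebraMap_end_apply] using norm_aeval_apply_le hs hμ hM habs x

end Polynomial

end Operators

/-! ### Chebyshev polynomials -/

section Chebyshev

open Polynomial

theorem cosh_sub_one_le_sq {θ : ℝ} (hθ : |θ| ≤ 1) : Real.cosh θ - 1 ≤ θ ^ 2 := by
  have hθ2 : θ ^ 2 ≤ 1 := (sq_le_one_iff_abs_le_one θ).2 hθ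
  have hexp := (abs_le.1 (Real.abs_exp_sub_one_sub_id_le (x := θ ^ 2 / 2) (by
    rw [abs_of_nonneg (by positivity)]
    linarith))).2
  nlinarith [Real.cosh_le_exp_half_sq θ, sq_nonneg θ]

theorem inv_cosh_le (x : ℝ) : (Real.cosh x)⁻¹ ≤ 2 * Real.exp (-x) := by
  have hcosh : Real.exp x / 2 ≤ Real.cosh x := by
    rw [Real.cosh_eq]
    linarith [Real.exp_pos (-x)]
  calc (Real.cosh x)⁻¹ ≤ (Real.exp x / 2)⁻¹ := inv_anti₀ (by positivity) hcosh
    _ = 2 * Real.exp (-x) := by rw [Real.exp_neg, inv_div, div_eq_mul_inv]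

-- The witness is `T_N(cosh θ - B t) / cosh(N θ)`, with `B` such that `cosh θ - B μ = 1`.
theorem exists_polynomial_abs_eval_le_inv_cosh {μ M θ : ℝ} (hμ : 0 < μ)
    (hM : (Real.cosh θ - 1) * M ≤ (Real.cosh θ + 1) * μ) (N : ℕ) :
    ∃ p : ℝ[X], p.natDegree ≤ N ∧ p.eval 0 = 1 ∧
      ∀ t ∈ Icc μ M, |p.eval t| ≤ (Real.cosh (N * θ))⁻¹ := by
  set B : ℝ := (Real.cosh θ - 1) / μ with hB
  have hB0 : 0 ≤ B := div_nonneg (sub_nonneg.2 (Real.one_le_cosh θ)) hμ.le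
  have hBμ : B * μ = Real.cosh θ - 1 := div_mul_cancel₀ _ hμ.ne'
  have hBM : B * M ≤ Real.cosh θ + 1 := by rwa [hB, div_mul_eq_mul_div, div_le_iff₀ hμ]
  let q : ℝ[X] := C (Real.cosh θ) - C B * X
  have hq (t : ℝ) : q.eval t = Real.cosh θ - B * t := by simp [q]
  have hqdeg : q.natDegree ≤ 1 :=
    (natDegree_sub_le _ _).trans
      (max_le (by simp) ((natDegree_C_mul_le B X).trans natDegree_X_le))
  refine ⟨C (Real.cosh (N * θ))⁻¹ * (Chebyshev.T ℝ N).comp q, ?_, ?_, ?_⟩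
  · refine ((natDegree_C_mul_le _ _).trans natDegree_comp_le).trans ?_
    rw [Chebyshev.natDegree_T]
    simpa using Nat.mul_le_mul_left N hqdeg
  · rw [eval_mul, eval_C, eval_comp, hq, mul_zero, sub_zero, Chebyshev.T_real_cosh]
    exact inv_mul_cancel₀ (Real.cosh_pos _).ne'
  · rintro t ⟨hμt, htM⟩
    have hqt : |q.eval t| ≤ 1 := by
      rw [hq, abs_le]
      constructor
      · linarith [mul_le_mul_of_nonneg_left htM hB0]
      · linarith [mul_le_mul_of_nonneg_left hμt hB0]
    have hcosh := inv_nonneg.2 (Real.cosh_pos (N * θ)).le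
    rw [eval_mul, eval_C, eval_comp, abs_mul, abs_of_nonneg hcosh]
    exact mul_le_of_le_one_right hcosh (Chebyshev.abs_eval_T_real_le_one N hqt)

theorem exists_polynomial_abs_eval_le_exp {μ M κ : ℝ} (hμ : 0 < μ) (hκ : 1 ≤ κ)
    (hM : M ≤ κ * μ) (N : ℕ) :
    ∃ p : ℝ[X], p.natDegree ≤ N ∧ p.eval 0 = 1 ∧
      ∀ t ∈ Icc μ M, |p.eval t| ≤ 2 * Real.exp (-(N / √κ)) := by
  have hκ0 : 0 < κ := by linarith
  set θ : ℝ := (√κ)⁻¹ with hθ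
  have hθ1 : |θ| ≤ 1 := by
    rw [abs_of_nonneg (by positivity)]
    exact inv_le_one_of_one_le₀ (Real.one_le_sqrt.2 hκ)
  have hθκ : θ ^ 2 * κ = 1 := by rw [hθ, inv_pow, Real.sq_sqrt hκ0.le, inv_mul_cancel₀ hκ0.ne']
  have hcosh1 := Real.one_le_cosh θ
  have hinterval : (Real.cosh θ - 1) * M ≤ (Real.cosh θ + 1) * μ :=
    calc (Real.cosh θ - 1) * M ≤ (Real.cosh θ - 1) * (κ * μ) :=
          mul_le_mul_of_nonneg_left hM (by linarith)
      _ ≤ θ ^ 2 * (κ * μ) := by gcongr; exact cosh_sub_one_le_sq hθ1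
      _ = 1 * μ := by rw [← mul_assoc, hθκ]
      _ ≤ (Real.cosh θ + 1) * μ := by gcongr; linarith
  obtain ⟨p, hdeg, h0, hp⟩ := exists_polynomial_abs_eval_le_inv_cosh hμ hinterval N
  exact ⟨p, hdeg, h0, fun t ht => (hp t ht).trans (inv_cosh_le _)⟩

end Chebyshev

/-! ### Conjugate gradient -/

@[simp] theorem val_bind {A B : Type} (c : Counted A) (k : A → Counted B) :
    (c >>= k).val = (k c.val).val := rfl

@[simp] theorem val_pure {A : Type} (x : A) : (pure x : Counted A).val = x := rfl

section ConjugateGradient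

variable {n : ℕ} {H : Vec n →L[ℝ] Vec n} {O : Vec n → Counted (Vec n)} {b : Vec n} {N : ℕ}
  {s : CGState n}

/-- The step length of an exact line search for `½⟨H v, v⟩ - ⟨b, v⟩` along the search direction. -/
def cgStepLength (H : Vec n →L[ℝ] Vec n) (s : CGState n) : ℝ :=
  ‖s.res‖ ^ 2 / ⟪s.dir, H s.dir⟫_ℝ

/-- The residual after a conjugate gradient step, without the stopping rule. -/
def cgNextRes (H : Vec n →L[ℝ] Vec n) (s : CGState n) : Vec n :=
  s.res - cgStepLength H s • H s.dir

/-- The search direction after a conjugate gradient step, without the stopping rule. -/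
def cgNextDir (H : Vec n →L[ℝ] Vec n) (s : CGState n) : Vec n :=
  cgNextRes H s + (‖cgNextRes H s‖ ^ 2 / ‖s.res‖ ^ 2) • s.dir

theorem val_cgStep_of_res_eq_zero (hr : s.res = 0) : (cgStep O s).val = s := by
  rw [cgStep, if_pos hr, val_pure]

theorem val_cgStep_of_res_ne_zero (hO : ∀ v, (O v).val = H v) (hr : s.res ≠ 0) :
    (cgStep O s).val =
      ⟨s.sol + cgStepLength H s • s.dir, cgNextRes H s, cgNextDir H s⟩ := by
  rw [cgStep, if_neg hr]
  simp only [val_bind, val_pure, hO]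
  rfl

theorem res_cgIter (hO : ∀ v, (O v).val = H v) (b : Vec n) (N : ℕ) :
    (cgIter O ⟨0, b, b⟩ N).val.res = b - H (cgIter O ⟨0, b, b⟩ N).val.sol := by
  induction N with
  | zero => simp [cgIter]
  | succ N ih =>
    rw [cgIter, val_bind]
    by_cases hr : (cgIter O ⟨0, b, b⟩ N).val.res = 0
    · rw [val_cgStep_of_res_eq_zero hr, ih]
    · rw [val_cgStep_of_res_ne_zero hO hr]
      simp only [cgNextRes, ih, map_add, map_smul]
      abel

theorem forall_mem_sup_span_singleton {R M : Type*} [Ring R] [AddCommGroup M] [Module R M]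
    {W : Submodule R M} {d : M} {P : M → Prop} (hP : ∀ w ∈ W, ∀ t : R, P (w + t • d)) :
    ∀ z ∈ W ⊔ Submodule.span R {d}, P z := by
  intro z hz
  obtain ⟨w, hw, y, hy, rfl⟩ := Submodule.mem_sup.1 hz
  obtain ⟨t, rfl⟩ := Submodule.mem_span_singleton.1 hy
  exact hP w hw t

/-- The state of conjugate gradient for `H v = b` after `N` iterations with nonzero residuals; `W`
stands for the span of the search directions already used. -/
structure CGInvariant (H : Vec n →L[ℝ] Vec n) (b : Vec n) (N : ℕ) (s : CGState n)
    (W : Submodule ℝ (Vec n)) : Prop where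
  sol_mem : s.sol ∈ W
  res_orthogonal : ∀ z ∈ W, ⟪s.res, z⟫_ℝ = 0
  dir_conjugate : ∀ z ∈ W, ⟪s.dir, H z⟫_ℝ = 0
  dir_sub_res_mem : s.dir - s.res ∈ W
  map_mem : ∀ z ∈ W, H z ∈ W ⊔ Submodule.span ℝ {s.dir}
  rhs_mem : b ∈ W ⊔ Submodule.span ℝ {s.dir}
  krylov_mem : ∀ q : Polynomial ℝ, q.natDegree < N → Polynomial.aeval H.toLinearMap q b ∈ W

namespace CGInvariant

variable {W : Submodule ℝ (Vec n)} (h : CGInvariant H b N s W)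
include h

theorem inner_res_dir : ⟪s.res, s.dir⟫_ℝ = ‖s.res‖ ^ 2 := by
  have horth := h.res_orthogonal _ h.dir_sub_res_mem
  rw [inner_sub_right, real_inner_self_eq_norm_sq] at horth
  linarith

theorem inner_dir_map_pos {μ : ℝ} (hμ0 : 0 < μ) (hμ : ∀ v, μ * ‖v‖ ^ 2 ≤ ⟪H v, v⟫_ℝ)
    (hr : s.res ≠ 0) : 0 < ⟪s.dir, H s.dir⟫_ℝ := by
  have hdir : s.dir ≠ 0 := by
    rintro hdir
    have hzero := h.inner_res_dir
    rw [hdir, inner_zero_right, eq_comm, sq_eq_zero_iff, norm_eq_zero] at hzero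
    exact hr hzero
  rw [real_inner_comm]
  exact (mul_pos hμ0 (pow_pos (norm_pos_iff.2 hdir) 2)).trans_le (hμ _)

theorem res_mem : s.res ∈ W ⊔ Submodule.span ℝ {s.dir} := by
  have hmem := Submodule.sub_mem _ (Submodule.mem_sup_right (Submodule.mem_span_singleton_self _))
    (Submodule.mem_sup_left (T := Submodule.span ℝ {s.dir}) h.dir_sub_res_mem)
  rwa [sub_sub_cancel] at hmem

theorem inner_nextRes (hs : H.toLinearMap.IsSymmetric) (hdir : 0 < ⟪s.dir, H s.dir⟫_ℝ) :
    ∀ z ∈ W ⊔ Submodule.span ℝ {s.dir}, ⟪cgNextRes H s, z⟫_ℝ = 0 := by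
  refine forall_mem_sup_span_singleton fun w hw t => ?_
  have hHw : ⟪H s.dir, w⟫_ℝ = 0 := (hs s.dir w).trans (h.dir_conjugate w hw)
  rw [cgNextRes, inner_add_right, inner_sub_left, inner_sub_left, real_inner_smul_right,
    real_inner_smul_right, real_inner_smul_left, real_inner_smul_left, h.res_orthogonal w hw, hHw,
    h.inner_res_dir, real_inner_comm, cgStepLength]
  field_simp
  ring

-- `a H d = r - r'`, and the new residual `r'` is orthogonal to `r`.
theorem stepLength_mul_inner_nextRes_map (hs : H.toLinearMap.IsSymmetric)
    (hdir : 0 < ⟪s.dir, H s.dir⟫_ℝ) :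
    cgStepLength H s * ⟪cgNextRes H s, H s.dir⟫_ℝ = -‖cgNextRes H s‖ ^ 2 := by
  have hmap : cgStepLength H s • H s.dir = s.res - cgNextRes H s := by rw [cgNextRes]; abel
  rw [← real_inner_smul_right, hmap, inner_sub_right, h.inner_nextRes hs hdir _ h.res_mem,
    real_inner_self_eq_norm_sq, zero_sub]

theorem inner_nextDir_map (hs : H.toLinearMap.IsSymmetric) (hdir : 0 < ⟪s.dir, H s.dir⟫_ℝ)
    (hr : s.res ≠ 0) :
    ∀ z ∈ W ⊔ Submodule.span ℝ {s.dir}, ⟪cgNextDir H s, H z⟫_ℝ = 0 := by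
  refine forall_mem_sup_span_singleton fun w hw t => ?_
  have : ‖s.res‖ ≠ 0 := norm_ne_zero_iff.2 hr
  have hHw : ⟪cgNextRes H s, H w⟫_ℝ = 0 := h.inner_nextRes hs hdir _ (h.map_mem w hw)
  have hHdir : ⟪cgNextRes H s, H s.dir⟫_ℝ =
      -‖cgNextRes H s‖ ^ 2 * ⟪s.dir, H s.dir⟫_ℝ / ‖s.res‖ ^ 2 := by
    rw [← h.stepLength_mul_inner_nextRes_map hs hdir, cgStepLength]
    field_simp
  rw [cgNextDir, map_add, map_smul, inner_add_right, inner_add_left, inner_add_left,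
    real_inner_smul_left, real_inner_smul_left, real_inner_smul_right, real_inner_smul_right,
    hHw, h.dir_conjugate w hw, hHdir]
  ring

theorem map_mem_next (ha : cgStepLength H s ≠ 0) :
    ∀ z ∈ W ⊔ Submodule.span ℝ {s.dir},
      H z ∈ W ⊔ Submodule.span ℝ {s.dir} ⊔ Submodule.span ℝ {cgNextDir H s} := by
  set W₁ := W ⊔ Submodule.span ℝ {s.dir}
  set W₂ := W₁ ⊔ Submodule.span ℝ {cgNextDir H s}
  have hW : W₁ ≤ W₂ := le_sup_left
  have hdir : s.dir ∈ W₂ :=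
    hW (Submodule.mem_sup_right (Submodule.mem_span_singleton_self _))
  have hnextDir : cgNextDir H s ∈ W₂ :=
    Submodule.mem_sup_right (Submodule.mem_span_singleton_self _)
  have hnextRes : cgNextRes H s ∈ W₂ := by
    rw [← add_sub_cancel_right (cgNextRes H s)]
    exact W₂.sub_mem hnextDir (W₂.smul_mem _ hdir)
  have hHdir : H s.dir ∈ W₂ := by
    rw [← W₂.smul_mem_iff ha, ← sub_sub_cancel s.res (cgStepLength H s • H s.dir)]
    exact W₂.sub_mem (hW h.res_mem) hnextRes
  refine forall_mem_sup_span_singleton fun w hw t => ?_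
  rw [map_add, map_smul]
  exact W₂.add_mem (hW (h.map_mem w hw)) (W₂.smul_mem t hHdir)

theorem krylov_mem_next (q : Polynomial ℝ) (hq : q.natDegree < N + 1) :
    Polynomial.aeval H.toLinearMap q b ∈ W ⊔ Submodule.span ℝ {s.dir} := by
  rcases Nat.eq_zero_or_pos q.natDegree with hdeg | hdeg
  · rw [Polynomial.eq_C_of_natDegree_eq_zero hdeg]
    simpa [Module.algebraMap_end_apply] using Submodule.smul_mem _ _ h.rhs_mem
  · have hdivX : q.divX.natDegree < N := by
      rw [Polynomial.natDegree_divX_eq_natDegree_tsub_one]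
      omega
    rw [← Polynomial.divX_mul_X_add q, mul_comm, map_add, map_mul, Polynomial.aeval_X,
      Polynomial.aeval_C]
    exact Submodule.add_mem _ (h.map_mem _ (h.krylov_mem _ hdivX))
      (Submodule.smul_mem _ (q.coeff 0) h.rhs_mem)

theorem step (hs : H.toLinearMap.IsSymmetric) {μ : ℝ} (hμ0 : 0 < μ)
    (hμ : ∀ v, μ * ‖v‖ ^ 2 ≤ ⟪H v, v⟫_ℝ) (hO : ∀ v, (O v).val = H v) (hr : s.res ≠ 0) :
    CGInvariant H b (N + 1) (cgStep O s).val (W ⊔ Submodule.span ℝ {s.dir}) := by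
  have hpos : 0 < ⟪s.dir, H s.dir⟫_ℝ := h.inner_dir_map_pos hμ0 hμ hr
  have hlength : cgStepLength H s ≠ 0 :=
    div_ne_zero (pow_ne_zero 2 (norm_ne_zero_iff.2 hr)) hpos.ne'
  have hdir : s.dir ∈ W ⊔ Submodule.span ℝ {s.dir} :=
    Submodule.mem_sup_right (Submodule.mem_span_singleton_self _)
  rw [val_cgStep_of_res_ne_zero hO hr]
  exact
    { sol_mem :=
        Submodule.add_mem _ (Submodule.mem_sup_left h.sol_mem) (Submodule.smul_mem _ _ hdir)
      res_orthogonal := h.inner_nextRes hs hpos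
      dir_conjugate := h.inner_nextDir_map hs hpos hr
      dir_sub_res_mem := by
        rw [cgNextDir, add_sub_cancel_left]
        exact Submodule.smul_mem _ _ hdir
      map_mem := h.map_mem_next hlength
      rhs_mem := Submodule.mem_sup_left h.rhs_mem
      krylov_mem := h.krylov_mem_next }

-- `1 - p(t)` is a multiple of `t`, so `x - p(H) x` is a polynomial of degree `< N` in `H` at `b`.
theorem aeval_sub_error_mem {x : Vec n} (hx : H x = b) {p : Polynomial ℝ} (hN : 0 < N)
    (hp : p.natDegree ≤ N) (hp0 : p.eval 0 = 1) :
    Polynomial.aeval H.toLinearMap p x - (x - s.sol) ∈ W := by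
  have hdivX : p.divX.natDegree < N := by
    rw [Polynomial.natDegree_divX_eq_natDegree_tsub_one]
    omega
  have haeval : Polynomial.aeval H.toLinearMap p x =
      Polynomial.aeval H.toLinearMap p.divX b + x := by
    conv_lhs => rw [← Polynomial.divX_mul_X_add p, Polynomial.coeff_zero_eq_eval_zero, hp0]
    simp [hx]
  have hsplit : Polynomial.aeval H.toLinearMap p x - (x - s.sol) =
      Polynomial.aeval H.toLinearMap p.divX b + s.sol := by
    rw [haeval]
    abel
  rw [hsplit]
  exact W.add_mem (h.krylov_mem _ hdivX) h.sol_mem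

end CGInvariant

section Convergence

variable (hs : H.toLinearMap.IsSymmetric) {μ : ℝ} (hμ0 : 0 < μ)
  (hμ : ∀ v, μ * ‖v‖ ^ 2 ≤ ⟪H v, v⟫_ℝ) (hO : ∀ v, (O v).val = H v)
include hs hμ0 hμ hO

theorem res_cgIter_eq_zero_or_exists_cgInvariant (b : Vec n) (N : ℕ) :
    (cgIter O ⟨0, b, b⟩ N).val.res = 0 ∨
      ∃ W, CGInvariant H b N (cgIter O ⟨0, b, b⟩ N).val W := by
  induction N with
  | zero =>
    refine Or.inr ⟨⊥, ?_⟩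
    constructor <;> simp [cgIter, Submodule.mem_span_singleton_self]
  | succ N ih =>
    rw [cgIter, val_bind]
    by_cases hr : (cgIter O ⟨0, b, b⟩ N).val.res = 0
    · rw [val_cgStep_of_res_eq_zero hr]
      exact Or.inl hr
    · obtain ⟨W, hW⟩ := ih.resolve_left hr
      exact Or.inr ⟨_, hW.step hs hμ0 hμ hO hr⟩

theorem energy_cgIter_le {x : Vec n} (hx : H x = b) (hN : 0 < N) {p : Polynomial ℝ}
    (hp : p.natDegree ≤ N) (hp0 : p.eval 0 = 1) :
    ⟪H (x - (cgIter O ⟨0, b, b⟩ N).val.sol), x - (cgIter O ⟨0, b, b⟩ N).val.sol⟫_ℝ ≤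
      ⟪H (Polynomial.aeval H.toLinearMap p x), Polynomial.aeval H.toLinearMap p x⟫_ℝ := by
  have hpos (v : Vec n) : 0 ≤ ⟪H v, v⟫_ℝ := (by positivity : 0 ≤ μ * ‖v‖ ^ 2).trans (hμ v)
  have hmap : H (x - (cgIter O ⟨0, b, b⟩ N).val.sol) = (cgIter O ⟨0, b, b⟩ N).val.res := by
    rw [res_cgIter hO, map_sub, hx]
  refine inner_map_le_inner_map_of_inner_map_sub_eq_zero hs hpos ?_
  rw [ContinuousLinearMap.coe_coe, hmap]
  rcases res_cgIter_eq_zero_or_exists_cgInvariant hs hμ0 hμ hO b N with hres | ⟨W, hW⟩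
  · rw [hres, inner_zero_left]
  · exact hW.res_orthogonal _ (hW.aeval_sub_error_mem hx hN hp hp0)

theorem norm_cg_sub_le_sqrt_mul_exp {M κ : ℝ} (hM : ∀ v, ⟪H v, v⟫_ℝ ≤ M * ‖v‖ ^ 2) (hκ : 1 ≤ κ)
    (hMκ : M ≤ κ * μ) {x : Vec n} (hx : H x = b) (T : ℕ) :
    ‖(cg O b T).val - x‖ ≤ √κ * (2 * Real.exp (-((T + 1 : ℕ) / √κ))) * ‖x‖ := by
  obtain ⟨p, hdeg, hp0, hp⟩ := exists_polynomial_abs_eval_le_exp hμ0 hκ hMκ (T + 1)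
  set d := Polynomial.aeval H.toLinearMap p x
  have henergy := energy_cgIter_le hs hμ0 hμ hO hx T.succ_pos hdeg hp0
  rw [show (cgIter O ⟨0, b, b⟩ (T + 1)).val.sol = (cg O b T).val from rfl] at henergy
  set e := x - (cg O b T).val
  have hsq : ‖e‖ ^ 2 ≤ (√κ * ‖d‖) ^ 2 := by
    refine le_of_mul_le_mul_left ?_ hμ0
    calc μ * ‖e‖ ^ 2 ≤ ⟪H d, d⟫_ℝ := (hμ e).trans henergy
      _ ≤ κ * μ * ‖d‖ ^ 2 := (hM d).trans (by gcongr)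
      _ = μ * (√κ * ‖d‖) ^ 2 := by rw [mul_pow, Real.sq_sqrt (by linarith)]; ring
  rw [norm_sub_rev, mul_assoc]
  refine (le_of_sq_le_sq hsq (by positivity)).trans ?_
  gcongr
  exact norm_aeval_apply_le hs hμ hM hp x

end Convergence

theorem exp_neg_four_le : Real.exp (-4) ≤ 1 / 20 := by
  have hexp : (20 : ℝ) ≤ Real.exp 4 := by
    rw [show (4 : ℝ) = (4 : ℕ) * 1 by norm_num, Real.exp_nat_mul]
    calc (20 : ℝ) ≤ 2.7 ^ 4 := by norm_num
      _ ≤ Real.exp 1 ^ 4 := by gcongr; linarith [Real.exp_one_gt_d9]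
  rw [Real.exp_neg, one_div]
  exact inv_anti₀ (by norm_num) hexp

theorem sqrt_mul_two_mul_exp_le {κ : ℝ} (hκ : 1 ≤ κ) {T : ℕ}
    (hT : 4 * (√κ * (1 + Real.log κ)) ≤ T) :
    √κ * (2 * Real.exp (-((T + 1 : ℕ) / √κ))) ≤ 1 / 10 := by
  have hκ0 : 0 < κ := by linarith
  have hlog : 0 ≤ Real.log κ := Real.log_nonneg hκ
  have hsqrt : √κ ≤ κ := Real.sqrt_le_self_iff.2 (Or.inr hκ)
  have hexponent : 4 + Real.log κ ≤ (T + 1 : ℕ) / √κ := by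
    rw [le_div_iff₀ (Real.sqrt_pos.2 hκ0)]
    push_cast
    nlinarith [Real.sqrt_nonneg κ]
  have hexp : Real.exp (-((T + 1 : ℕ) / √κ)) ≤ 1 / 20 * κ⁻¹ :=
    calc Real.exp (-((T + 1 : ℕ) / √κ)) ≤ Real.exp (-4 + -Real.log κ) := by gcongr; linarith
      _ = Real.exp (-4) * κ⁻¹ := by rw [Real.exp_add, Real.exp_neg (Real.log κ), Real.exp_log hκ0]
      _ ≤ 1 / 20 * κ⁻¹ := by gcongr; exact exp_neg_four_le
  calc √κ * (2 * Real.exp (-((T + 1 : ℕ) / √κ))) ≤ κ * (2 * (1 / 20 * κ⁻¹)) := by gcongr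
    _ = 1 / 10 := by field_simp; norm_num

end ConjugateGradient

/-! ### Smooth and strongly convex functions -/

section Calculus

variable {E F : Type*} [NormedAddCommGroup E] [NormedSpace ℝ E]
  [NormedAddCommGroup F] [NormedSpace ℝ F]

theorem le_of_hasDerivAt_of_forall_sub_le {φ : ℝ → ℝ} {φ' A B : ℝ} (hφ : HasDerivAt φ φ' 0)
    (h : ∀ t ∈ Ioo (0 : ℝ) 1, φ t - φ 0 ≤ t * A + t ^ 2 * B) : φ' ≤ A := by
  have hslope := hφ.tendsto_slope_zero_right
  have hbound : Filter.Tendsto (fun t : ℝ => A + t * B) (nhdsWithin 0 (Ioi 0))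
      (nhds (A + 0 * B)) :=
    (Continuous.tendsto (by fun_prop) 0).mono_left nhdsWithin_le_nhds
  have hle : φ' ≤ A + 0 * B := by
    refine le_of_tendsto_of_tendsto hslope hbound ?_
    filter_upwards [Ioo_mem_nhdsGT (zero_lt_one' ℝ)] with t ht
    rw [zero_add, smul_eq_mul, inv_mul_le_iff₀ ht.1]
    linarith [h t ht]
  linarith

theorem norm_image_one_sub_le {γ γ' : ℝ → F} {A C : ℝ} (h : ∀ t, HasDerivAt γ (γ' t) t)
    (hb : ∀ t, 0 ≤ t → ‖γ' t‖ ≤ A + C * t) : ‖γ 1 - γ 0‖ ≤ A + C / 2 := by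
  have hB : ∀ t : ℝ, HasDerivAt (fun t : ℝ => A * t + C / 2 * t ^ 2) (A + C * t) t := fun t => by
    refine (((hasDerivAt_id t).const_mul A).add
      ((hasDerivAt_pow 2 t).const_mul (C / 2))).congr_deriv ?_
    simp only [Nat.add_one_sub_one, pow_one, Nat.cast_ofNat]
    ring
  have hnorm := image_norm_le_of_norm_deriv_right_le_deriv_boundary (a := 0) (b := 1)
    (f := fun t => γ t - γ 0)
    (fun t _ => ((h t).sub_const _).continuousAt.continuousWithinAt)
    (fun t _ => ((h t).sub_const _).hasDerivWithinAt) (by simp) hB (fun t ht => hb t ht.1)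
    (x := 1) (by simp)
  simpa using hnorm

theorem hasDerivAt_comp_line {f : E → F} {f' : E →L[ℝ] F} {y k : E} {t : ℝ}
    (hf : HasFDerivAt f f' (y + t • k)) : HasDerivAt (fun t : ℝ => f (y + t • k)) (f' k) t := by
  have hline : HasDerivAt (fun t : ℝ => y + t • k) k t := by
    simpa using ((hasDerivAt_id t).smul_const k).const_add y
  exact hf.comp_hasDerivAt t hline

theorem norm_taylor_le {f : E → F} {f' : E → E →L[ℝ] F} {L : ℝ}
    (hf : ∀ y, HasFDerivAt f (f' y) y) (hL : ∀ y z, ‖f' y - f' z‖ ≤ L * ‖y - z‖) (y k : E) :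
    ‖f (y + k) - f y - f' y k‖ ≤ L / 2 * ‖k‖ ^ 2 := by
  have hderiv : ∀ t : ℝ, HasDerivAt (fun t : ℝ => f (y + t • k) - t • f' y k)
      (f' (y + t • k) k - f' y k) t := fun t =>
    (hasDerivAt_comp_line (hf _)).sub (by simpa using (hasDerivAt_id t).smul_const (f' y k))
  have hbound : ∀ t : ℝ, 0 ≤ t → ‖f' (y + t • k) k - f' y k‖ ≤ 0 + L * ‖k‖ ^ 2 * t := by
    intro t ht
    have hlip := hL (y + t • k) y
    rw [add_sub_cancel_left, norm_smul, Real.norm_of_nonneg ht] at hlip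
    calc ‖f' (y + t • k) k - f' y k‖ ≤ ‖f' (y + t • k) - f' y‖ * ‖k‖ :=
          (f' (y + t • k) - f' y).le_opNorm k
      _ ≤ L * (t * ‖k‖) * ‖k‖ := by gcongr
      _ = 0 + L * ‖k‖ ^ 2 * t := by ring
  have htaylor := norm_image_one_sub_le hderiv hbound
  simp only [one_smul, zero_smul, add_zero, sub_zero] at htaylor
  rw [sub_right_comm]
  exact htaylor.trans_eq (by ring)

end Calculus

section Gradient

variable {E F : Type*} [NormedAddCommGroup E] [InnerProductSpace ℝ E] [CompleteSpace E]
  [NormedAddCommGroup F] [InnerProductSpace ℝ F] [CompleteSpace F]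

theorem hasGradientAt_comp_of_forall_inner_eq {h : F → ℝ} {γ : E → F} {γ' : E →L[ℝ] F} {x v : E}
    {w : F} (hh : HasGradientAt h w (γ x)) (hγ : HasFDerivAt γ γ' x)
    (hv : ∀ k, ⟪w, γ' k⟫_ℝ = ⟪v, k⟫_ℝ) : HasGradientAt (fun x' => h (γ x')) v x := by
  rw [hasGradientAt_iff_hasFDerivAt]
  refine (hh.hasFDerivAt.comp x hγ).congr_fderiv ?_
  ext k
  simpa using hv k

theorem hasDerivAt_comp_line_of_hasGradientAt {h : E → ℝ} {y v k : E} {t : ℝ}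
    (hh : HasGradientAt h v (y + t • k)) :
    HasDerivAt (fun t : ℝ => h (y + t • k)) ⟪v, k⟫_ℝ t := by
  simpa using hasDerivAt_comp_line hh.hasFDerivAt

theorem abs_taylor_gradient_le {h : E → ℝ} {h' : E → E} {L : ℝ}
    (hh : ∀ y, HasGradientAt h (h' y) y) (hL : ∀ y z, ‖h' y - h' z‖ ≤ L * ‖y - z‖) (y k : E) :
    |h (y + k) - h y - ⟪h' y, k⟫_ℝ| ≤ L / 2 * ‖k‖ ^ 2 := by
  have hdual : ∀ y z, ‖InnerProductSpace.toDual ℝ E (h' y) - InnerProductSpace.toDual ℝ E (h' z)‖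
      ≤ L * ‖y - z‖ := fun y z => by
    rw [← map_sub, LinearIsometryEquiv.norm_map]
    exact hL y z
  simpa using norm_taylor_le (fun y => (hh y).hasFDerivAt) hdual y k

section StrongConvexity

variable {h : E → ℝ} {μ : ℝ}

theorem strongConvexOn_lower_bound (hc : StrongConvexOn univ μ h) {y v : E}
    (hv : HasGradientAt h v y) (z : E) :
    h y + ⟪v, z - y⟫_ℝ + μ / 2 * ‖z - y‖ ^ 2 ≤ h z := by
  have hd : HasDerivAt (fun t : ℝ => h (y + t • (z - y))) ⟪v, z - y⟫_ℝ 0 :=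
    hasDerivAt_comp_line_of_hasGradientAt (by simpa using hv)
  have hle : ⟪v, z - y⟫_ℝ ≤ h z - h y - μ / 2 * ‖z - y‖ ^ 2 := by
    refine le_of_hasDerivAt_of_forall_sub_le (B := μ / 2 * ‖z - y‖ ^ 2) hd fun t ht => ?_
    have hseg : (1 - t) • y + t • z = y + t • (z - y) := by
      rw [sub_smul, smul_sub, one_smul]
      abel
    have hconv := hc.2 (mem_univ y) (mem_univ z) (sub_nonneg.2 ht.2.le) ht.1.le (by ring)
    simp only [hseg, norm_sub_rev y z, smul_eq_mul] at hconv
    simp only [zero_smul, add_zero]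
    linarith
  linarith

theorem strongConvexOn_inner_gradient (hc : StrongConvexOn univ μ h) {y z v w : E}
    (hv : HasGradientAt h v y) (hw : HasGradientAt h w z) :
    μ * ‖y - z‖ ^ 2 ≤ ⟪v - w, y - z⟫_ℝ := by
  have hz := strongConvexOn_lower_bound hc hv z
  have hy := strongConvexOn_lower_bound hc hw y
  rw [norm_sub_rev, ← neg_sub y z, inner_neg_right] at hz
  rw [inner_sub_left]
  linarith

theorem eq_zero_of_hasGradientAt_of_forall_le {y v : E} (hv : HasGradientAt h v y)
    (hmin : ∀ z, h y ≤ h z) : v = 0 := by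
  have hlocal : IsLocalMin h y := Filter.Eventually.of_forall hmin
  simpa using hlocal.hasFDerivAt_eq_zero hv.hasFDerivAt

theorem exists_forall_le_of_strongConvexOn [FiniteDimensional ℝ E] (hμ : 0 < μ)
    (hc : StrongConvexOn univ μ h) (hd : Differentiable ℝ h) : ∃ y, ∀ z, h y ≤ h z := by
  refine hd.continuous.exists_forall_le ?_
  have hv := (hd 0).hasGradientAt
  set v := gradient h 0
  have hquad : Filter.Tendsto (fun t : ℝ => t * (μ / 2 * t - ‖v‖) + h 0) Filter.atTop
      Filter.atTop :=
    Filter.tendsto_atTop_add_const_right _ _ <| Filter.tendsto_id.atTop_mul_atTop₀ <|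
      Filter.tendsto_atTop_add_const_right _ _ <| Filter.tendsto_id.const_mul_atTop (by positivity)
  refine Filter.tendsto_atTop_mono (fun z => ?_)
    (hquad.comp (tendsto_norm_cocompact_atTop (E := E)))
  have hlower := strongConvexOn_lower_bound hc hv z
  have hinner := (abs_le.1 (abs_real_inner_le_norm v z)).1
  simp only [sub_zero] at hlower
  simp only [Function.comp_apply]
  linarith

theorem isSymmetric_of_hasGradientAt {h' : E → E} {H : E →L[ℝ] E} {y : E}
    (hh : ∀ y, HasGradientAt h (h' y) y) (hH : HasFDerivAt h' H y) :
    H.toLinearMap.IsSymmetric := by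
  let B : E →L[ℝ] E →L[ℝ] ℝ := (isBoundedBilinearMap_inner (𝕜 := ℝ) (E := E)).toContinuousLinearMap
  have hfirst : ∀ y, HasFDerivAt h (B (h' y)) y := fun y => (hh y).hasFDerivAt
  have hsecond : HasFDerivAt (fun y => B (h' y)) (B.comp H) y := B.hasFDerivAt.comp y hH
  intro v w
  rw [real_inner_comm (H.toLinearMap w) v]
  exact second_derivative_symmetric hfirst hsecond v w

theorem coercive_of_hasGradientAt {h' : E → E} {H : E →L[ℝ] E} {y : E}
    (hc : StrongConvexOn univ μ h) (hh : ∀ y, HasGradientAt h (h' y) y) (hH : HasFDerivAt h' H y)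
    (v : E) : μ * ‖v‖ ^ 2 ≤ ⟪H v, v⟫_ℝ := by
  have hline : HasDerivAt (fun t : ℝ => h' (y + t • v)) (H v) 0 :=
    hasDerivAt_comp_line (by simpa using hH)
  have hd : HasDerivAt (fun t : ℝ => -⟪h' (y + t • v), v⟫_ℝ) (-⟪H v, v⟫_ℝ) 0 :=
    (hline.inner ℝ (hasDerivAt_const 0 v)).neg.congr_deriv (by simp)
  have hle : -⟪H v, v⟫_ℝ ≤ -(μ * ‖v‖ ^ 2) := by
    refine le_of_hasDerivAt_of_forall_sub_le (B := 0) hd fun t ht => ?_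
    have hmono := strongConvexOn_inner_gradient hc (hh (y + t • v)) (hh y)
    rw [add_sub_cancel_left, norm_smul, Real.norm_of_nonneg ht.1.le, inner_smul_right] at hmono
    have hcancel : t * (μ * ‖v‖ ^ 2) ≤ ⟪h' (y + t • v) - h' y, v⟫_ℝ :=
      le_of_mul_le_mul_left (by linarith) ht.1
    rw [inner_sub_left] at hcancel
    simp only [zero_smul, add_zero]
    linarith
  linarith

theorem norm_sq_gradient_le_sub_of_forall_le {h' : E → E} {L : ℝ} (hL0 : 0 < L)
    (hh : ∀ y, HasGradientAt h (h' y) y) (hL : ∀ y z, ‖h' y - h' z‖ ≤ L * ‖y - z‖) {z : E}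
    (hz : ∀ y, h z ≤ h y) (y : E) : 1 / L * ‖h' y‖ ^ 2 / 2 ≤ h y - h z := by
  have hdescent := (abs_le.1 (abs_taylor_gradient_le hh hL y (-(1 / L) • h' y))).2
  have hmin := hz (y + -(1 / L) • h' y)
  rw [inner_smul_right, real_inner_self_eq_norm_sq, norm_smul, mul_pow, Real.norm_eq_abs,
    sq_abs] at hdescent
  have hquad : L / 2 * ((-(1 / L)) ^ 2 * ‖h' y‖ ^ 2) = 1 / L * ‖h' y‖ ^ 2 / 2 := by field_simp
  linarith

theorem norm_gradient_step_sub_sq_le {h' : E → E} {L β : ℝ} (hL0 : 0 < L)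
    (hc : StrongConvexOn univ μ h) (hh : ∀ y, HasGradientAt h (h' y) y)
    (hL : ∀ y z, ‖h' y - h' z‖ ≤ L * ‖y - z‖) (hβ0 : 0 < β) (hβ : β ≤ 1 / L) {z : E}
    (hz : ∀ y, h z ≤ h y) (y : E) :
    ‖y - β • h' y - z‖ ^ 2 ≤ (1 - β * μ) * ‖y - z‖ ^ 2 := by
  have hexpand : ‖y - β • h' y - z‖ ^ 2
      = ‖y - z‖ ^ 2 + 2 * β * ⟪h' y, z - y⟫_ℝ + β ^ 2 * ‖h' y‖ ^ 2 := by
    rw [sub_right_comm, norm_sub_sq_real, inner_smul_right, norm_smul, mul_pow, Real.norm_eq_abs,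
      sq_abs, ← neg_sub y z, inner_neg_right, real_inner_comm]
    ring
  have hinner : ⟪h' y, z - y⟫_ℝ + μ / 2 * ‖y - z‖ ^ 2 + 1 / L * ‖h' y‖ ^ 2 / 2 ≤ 0 := by
    have hlower := strongConvexOn_lower_bound hc (hh y) z
    rw [norm_sub_rev z y] at hlower
    linarith [norm_sq_gradient_le_sub_of_forall_le hL0 hh hL hz y]
  have hscaled := mul_nonpos_of_nonneg_of_nonpos (by positivity : 0 ≤ 2 * β) hinner
  have hstep : β * (β * ‖h' y‖ ^ 2) ≤ β * (1 / L * ‖h' y‖ ^ 2) := by gcongr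
  linarith

end StrongConvexity

end Gradient

/-! ### The bilevel problem -/

section Points

variable {m n : ℕ}

theorem pt_sub (x x' : Vec m) (y y' : Vec n) : pt x y - pt x' y' = pt (x - x') (y - y') := rfl

theorem pt_add (x x' : Vec m) (y y' : Vec n) : pt x y + pt x' y' = pt (x + x') (y + y') := rfl

theorem norm_pt_sq (x : Vec m) (y : Vec n) : ‖pt x y‖ ^ 2 = ‖x‖ ^ 2 + ‖y‖ ^ 2 :=
  WithLp.prod_norm_sq_eq_of_L2 _

theorem norm_pt_le (x : Vec m) (y : Vec n) : ‖pt x y‖ ≤ ‖x‖ + ‖y‖ := by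
  refine le_of_sq_le_sq ?_ (by positivity)
  rw [norm_pt_sq]
  nlinarith [norm_nonneg x, norm_nonneg y]

theorem norm_pt_sub_left (x x' : Vec m) (y : Vec n) : ‖pt x y - pt x' y‖ = ‖x - x'‖ := by
  rw [pt_sub, sub_self]
  exact WithLp.norm_toLp_fst ..

theorem norm_pt_sub_right (x : Vec m) (y y' : Vec n) : ‖pt x y - pt x y'‖ = ‖y - y'‖ := by
  rw [pt_sub, sub_self]
  exact WithLp.norm_toLp_snd ..

theorem inner_pt (p : Joint m n) (x : Vec m) (y : Vec n) :
    ⟪p, pt x y⟫_ℝ = ⟪p.fst, x⟫_ℝ + ⟪p.snd, y⟫_ℝ :=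
  WithLp.prod_inner_apply _ _

theorem hasGradientAt_grad1 {h : Joint m n → ℝ} {x : Vec m} {y : Vec n}
    (hd : DifferentiableAt ℝ h (pt x y)) : HasGradientAt (fun x' => h (pt x' y)) (grad1 h x y) x :=
  hasGradientAt_comp_of_forall_inner_eq hd.hasGradientAt
    ((WithLp.prodContinuousLinearEquiv 2 ℝ (Vec m) (Vec n)).symm.hasFDerivAt.comp x
      ((hasFDerivAt_id x).prodMk (hasFDerivAt_const y x)))
    fun k => (inner_pt _ k 0).trans (by rw [inner_zero_right, add_zero]; rfl)

theorem hasGradientAt_grad2 {h : Joint m n → ℝ} {x : Vec m} {y : Vec n}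
    (hd : DifferentiableAt ℝ h (pt x y)) : HasGradientAt (fun y' => h (pt x y')) (grad2 h x y) y :=
  hasGradientAt_comp_of_forall_inner_eq hd.hasGradientAt
    ((WithLp.prodContinuousLinearEquiv 2 ℝ (Vec m) (Vec n)).symm.hasFDerivAt.comp y
      ((hasFDerivAt_const x y).prodMk (hasFDerivAt_id y)))
    fun k => (inner_pt _ 0 k).trans (by rw [inner_zero_right, zero_add]; rfl)

theorem norm_grad1_sub_le {h : Joint m n → ℝ} {L : ℝ}
    (hL : ∀ p q, ‖gradient h p - gradient h q‖ ≤ L * ‖p - q‖) (x x' : Vec m) (y y' : Vec n) :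
    ‖grad1 h x y - grad1 h x' y'‖ ≤ L * ‖pt x y - pt x' y'‖ :=
  (WithLp.norm_fst_le _ (gradient h (pt x y) - gradient h (pt x' y'))).trans (hL _ _)

theorem norm_grad2_sub_le {h : Joint m n → ℝ} {L : ℝ}
    (hL : ∀ p q, ‖gradient h p - gradient h q‖ ≤ L * ‖p - q‖) (x x' : Vec m) (y y' : Vec n) :
    ‖grad2 h x y - grad2 h x' y'‖ ≤ L * ‖pt x y - pt x' y'‖ :=
  (WithLp.norm_snd_le _ (gradient h (pt x y) - gradient h (pt x' y'))).trans (hL _ _)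

end Points

/-- The direction `∇₁ f(x, y) - ∇²₁₂ g(x, y) u` along which NBO-CG moves `x`. -/
def direction {m n : ℕ} (f g : Joint m n → ℝ) (x : Vec m) (y u : Vec n) : Vec m :=
  grad1 f x y - jac12 g x y u

/-- The hypergradient at `x`, i.e. the exact direction `∇₁ f(x, y*(x)) - ∇²₁₂ g(x, y*(x)) u*(x)`.
It is the gradient of `Φ` at `x`, see `Assumptions.hasGradientAt_Phi`. -/
def hypergradient {m n : ℕ} (f g : Joint m n → ℝ) (x : Vec m) : Vec m :=
  direction f g x (yStar g x) (uStar f g x)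

namespace Assumptions

variable {m n : ℕ} {f g : Joint m n → ℝ} {μ Lf1 Lg1 Lg2 Lf0 Cf0 : ℝ}
  (hA : Assumptions f g μ Lf1 Lg1 Lg2 Lf0 Cf0)

section LowerLevel

include hA

theorem hasGradientAt_g (x : Vec m) (y : Vec n) :
    HasGradientAt (fun y' => g (pt x y')) (grad2 g x y) y :=
  hasGradientAt_grad2 (hA.g_diff _)

theorem hasFDerivAt_grad1 (x : Vec m) (y : Vec n) :
    HasFDerivAt (fun y' => grad1 g x y') (jac12 g x y) y :=
  ((WithLp.fstL 2 ℝ (Vec m) (Vec n)).differentiableAt.comp y (hA.g_diff2 x y)).hasFDerivAt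

theorem hasFDerivAt_grad2 (x : Vec m) (y : Vec n) :
    HasFDerivAt (fun y' => grad2 g x y') (hess22 g x y) y :=
  ((WithLp.sndL 2 ℝ (Vec m) (Vec n)).differentiableAt.comp y (hA.g_diff2 x y)).hasFDerivAt

theorem norm_jac_le (hLg1 : 0 ≤ Lg1) (x : Vec m) (y : Vec n) : ‖jac12 g x y‖ ≤ Lg1 :=
  (hA.hasFDerivAt_grad1 x y).le_of_lip' hLg1 <| Filter.Eventually.of_forall fun y' =>
    norm_pt_sub_right x y' y ▸ norm_grad1_sub_le hA.g_grad_lip x x y' y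

theorem norm_hess_le (hLg1 : 0 ≤ Lg1) (x : Vec m) (y : Vec n) : ‖hess22 g x y‖ ≤ Lg1 :=
  (hA.hasFDerivAt_grad2 x y).le_of_lip' hLg1 <| Filter.Eventually.of_forall fun y' =>
    norm_pt_sub_right x y' y ▸ norm_grad2_sub_le hA.g_grad_lip x x y' y

theorem norm_jac_sub_le_left (x x' : Vec m) (y : Vec n) :
    ‖jac12 g x y - jac12 g x' y‖ ≤ Lg2 * ‖x - x'‖ :=
  norm_pt_sub_left x x' y ▸ hA.g_jac_lip x y x' y

theorem norm_jac_sub_le_right (x : Vec m) (y y' : Vec n) :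
    ‖jac12 g x y - jac12 g x y'‖ ≤ Lg2 * ‖y - y'‖ :=
  norm_pt_sub_right x y y' ▸ hA.g_jac_lip x y x y'

theorem norm_hess_sub_le_left (x x' : Vec m) (y : Vec n) :
    ‖hess22 g x y - hess22 g x' y‖ ≤ Lg2 * ‖x - x'‖ :=
  norm_pt_sub_left x x' y ▸ hA.g_hess_lip x y x' y

theorem norm_hess_sub_le_right (x : Vec m) (y y' : Vec n) :
    ‖hess22 g x y - hess22 g x y'‖ ≤ Lg2 * ‖y - y'‖ :=
  norm_pt_sub_right x y y' ▸ hA.g_hess_lip x y x y'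

theorem isSymmetric_hess (x : Vec m) (y : Vec n) : (hess22 g x y).toLinearMap.IsSymmetric :=
  isSymmetric_of_hasGradientAt (hA.hasGradientAt_g x) (hA.hasFDerivAt_grad2 x y)

theorem mul_norm_sq_le_inner_hess (x : Vec m) (y v : Vec n) :
    μ * ‖v‖ ^ 2 ≤ ⟪hess22 g x y v, v⟫_ℝ :=
  coercive_of_hasGradientAt (hA.g_strong x) (hA.hasGradientAt_g x) (hA.hasFDerivAt_grad2 x y) v

theorem mul_norm_le_norm_hess (x : Vec m) (y v : Vec n) : μ * ‖v‖ ≤ ‖hess22 g x y v‖ :=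
  mul_norm_le_norm_of_mul_norm_sq_le_inner (hA.mul_norm_sq_le_inner_hess x y v)

theorem inner_hess_le (hLg1 : 0 ≤ Lg1) (x : Vec m) (y v : Vec n) :
    ⟪hess22 g x y v, v⟫_ℝ ≤ Lg1 * ‖v‖ ^ 2 :=
  calc ⟪hess22 g x y v, v⟫_ℝ ≤ ‖hess22 g x y v‖ * ‖v‖ := real_inner_le_norm _ _
    _ ≤ Lg1 * ‖v‖ * ‖v‖ := by
      gcongr
      exact (hess22 g x y).le_of_opNorm_le (hA.norm_hess_le hLg1 x y) v
    _ = Lg1 * ‖v‖ ^ 2 := by ring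

end LowerLevel

section Implicit

variable (hμ : 0 < μ)
include hA hμ

theorem exists_hess_eq (x : Vec m) (y b : Vec n) : ∃ v, hess22 g x y v = b := by
  obtain ⟨e, he⟩ := isInvertible_of_coercive hμ (hA.mul_norm_sq_le_inner_hess x y)
  exact ⟨e.symm b, by simp [← he]⟩

theorem yStar_le (x : Vec m) (z : Vec n) : g (pt x (yStar g x)) ≤ g (pt x z) :=
  Classical.epsilon_spec (p := fun y => ∀ z, g (pt x y) ≤ g (pt x z))
    (exists_forall_le_of_strongConvexOn hμ (hA.g_strong x)
      fun y => (hA.hasGradientAt_g x y).differentiableAt) z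

theorem grad2_yStar (x : Vec m) : grad2 g x (yStar g x) = 0 :=
  eq_zero_of_hasGradientAt_of_forall_le (hA.hasGradientAt_g x _) (hA.yStar_le hμ x)

theorem mul_norm_sub_yStar_le (x : Vec m) (y : Vec n) :
    μ * ‖y - yStar g x‖ ≤ ‖grad2 g x y‖ := by
  have hmono := strongConvexOn_inner_gradient (hA.g_strong x) (hA.hasGradientAt_g x y)
    (hA.hasGradientAt_g x (yStar g x))
  rw [hA.grad2_yStar hμ, sub_zero] at hmono
  exact mul_norm_le_norm_of_mul_norm_sq_le_inner hmono

theorem norm_yStar_sub_le (x x' : Vec m) :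
    ‖yStar g x - yStar g x'‖ ≤ Lg1 / μ * ‖x - x'‖ := by
  have hlip := norm_grad2_sub_le hA.g_grad_lip x x' (yStar g x) (yStar g x)
  rw [hA.grad2_yStar hμ, zero_sub, norm_neg, norm_pt_sub_left] at hlip
  rw [div_mul_eq_mul_div, le_div_iff₀ hμ]
  linarith [hA.mul_norm_sub_yStar_le hμ x' (yStar g x)]

theorem hess_uStar (x : Vec m) :
    hess22 g x (yStar g x) (uStar f g x) = grad2 f x (yStar g x) :=
  ((isInvertible_of_coercive hμ
    (hA.mul_norm_sq_le_inner_hess x (yStar g x))).inverse_apply_eq.1 rfl).symm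

theorem norm_uStar_le (x : Vec m) : ‖uStar f g x‖ ≤ Lf0 / μ := by
  have hcoer := hA.mul_norm_le_norm_hess x (yStar g x) (uStar f g x)
  rw [hA.hess_uStar hμ] at hcoer
  rw [le_div_iff₀ hμ]
  linarith [hA.f_grad2_bound x]

theorem norm_sub_uStar_le (x x' : Vec m) (y w : Vec n)
    (hw : hess22 g x y w = grad2 f x y) :
    ‖w - uStar f g x'‖ ≤ (Lf1 + Lg2 * (Lf0 / μ)) / μ * ‖pt x y - pt x' (yStar g x')‖ := by
  set δ := ‖pt x y - pt x' (yStar g x')‖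
  have hsplit : hess22 g x y (w - uStar f g x') = (grad2 f x y - grad2 f x' (yStar g x'))
      - (hess22 g x y - hess22 g x' (yStar g x')) (uStar f g x') := by
    rw [map_sub, hw, sub_apply, hA.hess_uStar hμ]
    abel
  have hcoer := hA.mul_norm_le_norm_hess x y (w - uStar f g x')
  have hrhs : ‖grad2 f x y - grad2 f x' (yStar g x')‖ ≤ Lf1 * δ :=
    norm_grad2_sub_le hA.f_grad_lip x x' y (yStar g x')
  have hmatrix : ‖(hess22 g x y - hess22 g x' (yStar g x')) (uStar f g x')‖
      ≤ Lg2 * δ * (Lf0 / μ) :=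
    ContinuousLinearMap.le_of_opNorm_le_of_le _ (hA.g_hess_lip _ _ _ _) (hA.norm_uStar_le hμ x')
  rw [div_mul_eq_mul_div, le_div_iff₀ hμ]
  calc ‖w - uStar f g x'‖ * μ ≤ ‖hess22 g x y (w - uStar f g x')‖ := by rwa [mul_comm]
    _ ≤ Lf1 * δ + Lg2 * δ * (Lf0 / μ) := by rw [hsplit]; exact norm_sub_le_of_le hrhs hmatrix
    _ = (Lf1 + Lg2 * (Lf0 / μ)) * δ := by ring

theorem norm_uStar_sub_le (hLf1 : 0 ≤ Lf1) (hLg2 : 0 ≤ Lg2) (hLf0 : 0 ≤ Lf0) (x x' : Vec m) :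
    ‖uStar f g x - uStar f g x'‖ ≤
      (Lf1 + Lg2 * (Lf0 / μ)) / μ * ((1 + Lg1 / μ) * ‖x - x'‖) := by
  refine (hA.norm_sub_uStar_le hμ x x' _ _ (hA.hess_uStar hμ x)).trans ?_
  gcongr
  rw [pt_sub]
  linarith [norm_pt_le (x - x') (yStar g x - yStar g x'), hA.norm_yStar_sub_le hμ x x']

theorem norm_newton_sub_le (x : Vec m) (y v : Vec n) (hv : hess22 g x y v = grad2 g x y) :
    ‖y - v - yStar g x‖ ≤ Lg2 / (2 * μ) * ‖y - yStar g x‖ ^ 2 := by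
  have htaylor := norm_taylor_le (hA.hasFDerivAt_grad2 x) (hA.norm_hess_sub_le_right x) y
    (yStar g x - y)
  have herror : hess22 g x y (y - v - yStar g x)
      = 0 - grad2 g x y - hess22 g x y (yStar g x - y) := by
    rw [map_sub, map_sub, map_sub, hv]
    abel
  rw [add_sub_cancel, hA.grad2_yStar hμ, ← herror, norm_sub_rev (yStar g x) y] at htaylor
  rw [div_mul_eq_mul_div, le_div_iff₀ (by positivity)]
  linarith [hA.mul_norm_le_norm_hess x y (y - v - yStar g x)]

end Implicit

section MixedDerivative

include hA

theorem norm_grad1_sub_sub_jac_le (x h : Vec m) (y k : Vec n) :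
    ‖grad1 g (x + h) (y + k) - grad1 g (x + h) y - jac12 g x y k‖
      ≤ Lg2 / 2 * ‖k‖ ^ 2 + Lg2 * ‖h‖ * ‖k‖ := by
  have htaylor := norm_taylor_le (hA.hasFDerivAt_grad1 (x + h)) (hA.norm_jac_sub_le_right (x + h))
    y k
  have hjac := hA.norm_jac_sub_le_left (x + h) x y
  rw [add_sub_cancel_left] at hjac
  have hsplit : grad1 g (x + h) (y + k) - grad1 g (x + h) y - jac12 g x y k
      = (grad1 g (x + h) (y + k) - grad1 g (x + h) y - jac12 g (x + h) y k)
        + (jac12 g (x + h) y - jac12 g x y) k := by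
    rw [sub_apply]
    abel
  rw [hsplit]
  exact norm_add_le_of_le htaylor (ContinuousLinearMap.le_of_opNorm_le _ hjac k)

theorem abs_mixed_difference_sub_le (x h : Vec m) (y k : Vec n) :
    |g (pt (x + h) (y + k)) - g (pt (x + h) y) - (g (pt x (y + k)) - g (pt x y))
        - ⟪jac12 g x y k, h⟫_ℝ| ≤ Lg2 / 2 * ‖k‖ ^ 2 * ‖h‖ + Lg2 / 2 * ‖h‖ ^ 2 * ‖k‖ := by
  have hderiv : ∀ s : ℝ, HasDerivAt
      (fun s : ℝ => g (pt (x + s • h) (y + k)) - g (pt (x + s • h) y) - s * ⟪jac12 g x y k, h⟫_ℝ)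
      ⟪grad1 g (x + s • h) (y + k) - grad1 g (x + s • h) y - jac12 g x y k, h⟫_ℝ s := fun s => by
    rw [inner_sub_left, inner_sub_left]
    exact ((hasDerivAt_comp_line_of_hasGradientAt (hasGradientAt_grad1 (hA.g_diff _))).sub
      (hasDerivAt_comp_line_of_hasGradientAt (hasGradientAt_grad1 (hA.g_diff _)))).sub
      (by simpa using (hasDerivAt_id s).mul_const ⟪jac12 g x y k, h⟫_ℝ)
  have hbound : ∀ s : ℝ, 0 ≤ s →
      ‖⟪grad1 g (x + s • h) (y + k) - grad1 g (x + s • h) y - jac12 g x y k, h⟫_ℝ‖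
        ≤ Lg2 / 2 * ‖k‖ ^ 2 * ‖h‖ + Lg2 * ‖h‖ ^ 2 * ‖k‖ * s := fun s hs => by
    have hgrad := hA.norm_grad1_sub_sub_jac_le x (s • h) y k
    rw [norm_smul, Real.norm_of_nonneg hs] at hgrad
    calc _ ≤ ‖grad1 g (x + s • h) (y + k) - grad1 g (x + s • h) y - jac12 g x y k‖ * ‖h‖ :=
          norm_inner_le_norm _ _
      _ ≤ (Lg2 / 2 * ‖k‖ ^ 2 + Lg2 * (s * ‖h‖) * ‖k‖) * ‖h‖ := by gcongr
      _ = Lg2 / 2 * ‖k‖ ^ 2 * ‖h‖ + Lg2 * ‖h‖ ^ 2 * ‖k‖ * s := by ring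
  have hone := norm_image_one_sub_le hderiv hbound
  simp only [one_smul, one_mul, zero_smul, add_zero, zero_mul, sub_zero, Real.norm_eq_abs] at hone
  rw [sub_right_comm]
  exact hone.trans_eq (by ring)

-- Symmetry of the mixed second derivatives: `g` is not assumed to be twice differentiable in `x`,
-- so the derivative of `∇₂ g(·, y)` along `h` is read off the mixed second difference.
theorem inner_grad2_sub_sub_inner_jac_le (x h : Vec m) (y u : Vec n) :
    ⟪grad2 g (x + h) y - grad2 g x y, u⟫_ℝ - ⟪jac12 g x y u, h⟫_ℝ ≤ Lg2 / 2 * ‖h‖ ^ 2 * ‖u‖ := by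
  have hd : HasDerivAt (fun t : ℝ => g (pt (x + h) (y + t • u)) - g (pt x (y + t • u)))
      ⟪grad2 g (x + h) y - grad2 g x y, u⟫_ℝ 0 := by
    have hline : ∀ x', HasDerivAt (fun t : ℝ => g (pt x' (y + t • u))) ⟪grad2 g x' y, u⟫_ℝ 0 :=
      fun x' => by
        have hgrad := hA.hasGradientAt_g x' (y + (0 : ℝ) • u)
        simpa using hasDerivAt_comp_line_of_hasGradientAt hgrad
    rw [inner_sub_left]
    exact (hline (x + h)).sub (hline x)
  rw [sub_le_iff_le_add]
  refine le_of_hasDerivAt_of_forall_sub_le (B := Lg2 / 2 * ‖u‖ ^ 2 * ‖h‖) hd fun t ht => ?_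
  have hmixed := (abs_le.1 (hA.abs_mixed_difference_sub_le x h y (t • u))).2
  rw [norm_smul, Real.norm_of_nonneg ht.1.le, map_smul, real_inner_smul_left] at hmixed
  simp only [zero_smul, add_zero]
  linarith

theorem abs_inner_grad2_sub_sub_inner_jac_le (x h : Vec m) (y u : Vec n) :
    |⟪grad2 g (x + h) y - grad2 g x y, u⟫_ℝ - ⟪jac12 g x y u, h⟫_ℝ| ≤
      Lg2 / 2 * ‖h‖ ^ 2 * ‖u‖ := by
  have hneg := hA.inner_grad2_sub_sub_inner_jac_le x h y (-u)
  rw [map_neg, inner_neg_left, inner_neg_right, norm_neg] at hneg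
  exact abs_le.2 ⟨by linarith, hA.inner_grad2_sub_sub_inner_jac_le x h y u⟩

theorem abs_inner_grad2_taylor_le (x h : Vec m) (y k u : Vec n) :
    |⟪grad2 g (x + h) (y + k) - grad2 g x y, u⟫_ℝ - ⟪jac12 g x y u, h⟫_ℝ - ⟪hess22 g x y k, u⟫_ℝ|
      ≤ Lg2 / 2 * (‖h‖ + ‖k‖) ^ 2 * ‖u‖ := by
  have hhess := hA.norm_hess_sub_le_left (x + h) x y
  rw [add_sub_cancel_left] at hhess
  have hcross := hA.abs_inner_grad2_sub_sub_inner_jac_le x h y u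
  have htaylor := (abs_real_inner_le_norm (grad2 g (x + h) (y + k) - grad2 g (x + h) y
    - hess22 g (x + h) y k) u).trans <| mul_le_mul_of_nonneg_right
      (norm_taylor_le (hA.hasFDerivAt_grad2 (x + h)) (hA.norm_hess_sub_le_right (x + h)) y k)
      (norm_nonneg u)
  have hbase := (abs_real_inner_le_norm ((hess22 g (x + h) y - hess22 g x y) k) u).trans <|
    mul_le_mul_of_nonneg_right (ContinuousLinearMap.le_of_opNorm_le _ hhess k) (norm_nonneg u)
  simp only [sub_apply, inner_sub_left] at hcross htaylor hbase ⊢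
  rw [abs_le] at hcross htaylor hbase ⊢
  constructor <;> linarith [hcross.1, hcross.2, htaylor.1, htaylor.2, hbase.1, hbase.2]

end MixedDerivative

section Hypergradient

variable (hμ : 0 < μ)
include hA hμ

-- Implicit differentiation of `∇₂ g(x, y*(x)) = 0`, tested against `u*(x)`.
theorem abs_inner_jac_uStar_add_inner_le (x h : Vec m) :
    |⟪jac12 g x (yStar g x) (uStar f g x), h⟫_ℝ
        + ⟪grad2 f x (yStar g x), yStar g (x + h) - yStar g x⟫_ℝ|
      ≤ Lg2 / 2 * (‖h‖ + ‖yStar g (x + h) - yStar g x‖) ^ 2 * ‖uStar f g x‖ := by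
  have htaylor := hA.abs_inner_grad2_taylor_le x h (yStar g x) (yStar g (x + h) - yStar g x)
    (uStar f g x)
  have hsymm : ∀ k, ⟪hess22 g x (yStar g x) k, uStar f g x⟫_ℝ = ⟪grad2 f x (yStar g x), k⟫_ℝ :=
    fun k => by
      rw [← hA.hess_uStar hμ, real_inner_comm]
      exact (hA.isSymmetric_hess x (yStar g x) _ _).symm
  rwa [add_sub_cancel, hA.grad2_yStar hμ, hA.grad2_yStar hμ, sub_zero, inner_zero_left, hsymm,
    zero_sub, ← neg_add', abs_neg] at htaylor

theorem abs_Phi_sub_sub_inner_le (x h : Vec m) :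
    |Phi f g (x + h) - Phi f g x - ⟪hypergradient f g x, h⟫_ℝ| ≤
      Lf1 / 2 * (‖h‖ ^ 2 + ‖yStar g (x + h) - yStar g x‖ ^ 2)
        + Lg2 / 2 * (‖h‖ + ‖yStar g (x + h) - yStar g x‖) ^ 2 * ‖uStar f g x‖ := by
  have himplicit := hA.abs_inner_jac_uStar_add_inner_le hμ x h
  have houter := abs_taylor_gradient_le (fun p => (hA.f_diff p).hasGradientAt) hA.f_grad_lip
    (pt x (yStar g x)) (pt h (yStar g (x + h) - yStar g x))
  rw [norm_pt_sq, inner_pt, pt_add, add_sub_cancel] at houter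
  refine le_trans (le_of_eq_of_le ?_ (abs_add_le _ _)) (add_le_add houter himplicit)
  rw [hypergradient, direction, inner_sub_left]
  unfold Phi grad1 grad2
  congr 1
  ring

theorem abs_Phi_taylor_le (hLf1 : 0 ≤ Lf1) (hLg2 : 0 ≤ Lg2) {κ : ℝ} (hκ : 1 ≤ κ)
    (hLκ : Lg1 / μ ≤ κ) (x h : Vec m) :
    |Phi f g (x + h) - Phi f g x - ⟪hypergradient f g x, h⟫_ℝ|
      ≤ 3 * (Lf1 + Lg2 * (Lf0 / μ)) * κ ^ 2 * ‖h‖ ^ 2 := by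
  refine (hA.abs_Phi_sub_sub_inner_le hμ x h).trans ?_
  set r := ‖yStar g (x + h) - yStar g x‖
  have hr : r ≤ κ * ‖h‖ := by
    have hlip := hA.norm_yStar_sub_le hμ (x + h) x
    rw [add_sub_cancel_left] at hlip
    exact hlip.trans (by gcongr)
  have hh : ‖h‖ ≤ κ * ‖h‖ := le_mul_of_one_le_left (norm_nonneg h) hκ
  have hu := hA.norm_uStar_le hμ x
  have hu0 : 0 ≤ Lf0 / μ := (norm_nonneg _).trans hu
  calc _ ≤ Lf1 / 2 * ((κ * ‖h‖) ^ 2 + (κ * ‖h‖) ^ 2)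
        + Lg2 / 2 * (κ * ‖h‖ + κ * ‖h‖) ^ 2 * (Lf0 / μ) := by gcongr
    _ = (Lf1 + 2 * (Lg2 * (Lf0 / μ))) * (κ ^ 2 * ‖h‖ ^ 2) := by ring
    _ ≤ (3 * (Lf1 + Lg2 * (Lf0 / μ))) * (κ ^ 2 * ‖h‖ ^ 2) := by
      gcongr
      linarith [mul_nonneg hLg2 hu0]
    _ = 3 * (Lf1 + Lg2 * (Lf0 / μ)) * κ ^ 2 * ‖h‖ ^ 2 := by ring

theorem hasGradientAt_Phi (hLf1 : 0 ≤ Lf1) (hLg2 : 0 ≤ Lg2) (x : Vec m) :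
    HasGradientAt (Phi f g) (hypergradient f g x) x := by
  rw [hasGradientAt_iff_isLittleO_nhds_zero]
  refine Asymptotics.IsBigO.trans_isLittleO (g := fun h : Vec m => ‖h‖ ^ 2) ?_
    (Asymptotics.isLittleO_norm_pow_id one_lt_two)
  refine Asymptotics.IsBigO.of_bound (3 * (Lf1 + Lg2 * (Lf0 / μ)) * max 1 (Lg1 / μ) ^ 2)
    (Filter.Eventually.of_forall fun h => ?_)
  rw [Real.norm_eq_abs, Real.norm_of_nonneg (by positivity)]
  exact hA.abs_Phi_taylor_le hμ hLf1 hLg2 (le_max_left _ _) (le_max_right _ _) x h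

theorem norm_direction_sub_hypergradient_le (hLg1 : 0 ≤ Lg1) (x : Vec m) (y u : Vec n) :
    ‖direction f g x y u - hypergradient f g x‖ ≤
      (Lf1 + Lg2 * (Lf0 / μ)) * ‖y - yStar g x‖ + Lg1 * ‖u - uStar f g x‖ := by
  have hgrad : ‖grad1 f x y - grad1 f x (yStar g x)‖ ≤ Lf1 * ‖y - yStar g x‖ :=
    norm_pt_sub_right x y (yStar g x) ▸ norm_grad1_sub_le hA.f_grad_lip x x y (yStar g x)
  have hjac : ‖(jac12 g x y - jac12 g x (yStar g x)) (uStar f g x)‖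
      ≤ Lg2 * ‖y - yStar g x‖ * (Lf0 / μ) :=
    ContinuousLinearMap.le_of_opNorm_le_of_le _ (hA.norm_jac_sub_le_right x y _)
      (hA.norm_uStar_le hμ x)
  have hu : ‖jac12 g x y (u - uStar f g x)‖ ≤ Lg1 * ‖u - uStar f g x‖ :=
    ContinuousLinearMap.le_of_opNorm_le _ (hA.norm_jac_le hLg1 x y) _
  have hsplit : direction f g x y u - hypergradient f g x
      = (grad1 f x y - grad1 f x (yStar g x))
        - (jac12 g x y - jac12 g x (yStar g x)) (uStar f g x)
        - jac12 g x y (u - uStar f g x) := by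
    rw [hypergradient, direction, direction, sub_apply, map_sub]
    abel
  rw [hsplit]
  exact (norm_sub_le_of_le (norm_sub_le_of_le hgrad hjac) hu).trans_eq (by ring)

theorem norm_direction_le (hLg1 : 0 ≤ Lg1) (x : Vec m) (y : Vec n) {u : Vec n} {r : ℝ}
    (hu : ‖u - uStar f g x‖ ≤ r) : ‖direction f g x y u‖ ≤ Cf0 + Lg1 * (Lf0 / μ + r) := by
  have hu' : ‖u‖ ≤ Lf0 / μ + r := by
    rw [← add_sub_cancel (uStar f g x) u]
    exact norm_add_le_of_le (hA.norm_uStar_le hμ x) hu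
  exact norm_sub_le_of_le (hA.f_grad1_bound x y)
    (ContinuousLinearMap.le_of_opNorm_le_of_le _ (hA.norm_jac_le hLg1 x y) hu')

end Hypergradient

end Assumptions

/-! ### The outer iteration -/

theorem exists_lt_le_div_of_add_le {V G : ℕ → ℝ} {c B : ℝ} (hc : 0 < c)
    (hstep : ∀ k, V (k + 1) + c * G k ≤ V k) (hV : ∀ k, V 0 - V k ≤ B) {K : ℕ} (hK : 1 ≤ K) :
    ∃ k < K, G k ≤ B / (c * K) := by
  have hK0 : (0 : ℝ) < K := by exact_mod_cast hK
  have hsum : ∑ k ∈ Finset.range K, c * G k ≤ ∑ _k ∈ Finset.range K, B / K :=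
    calc ∑ k ∈ Finset.range K, c * G k ≤ ∑ k ∈ Finset.range K, (V k - V (k + 1)) :=
          Finset.sum_le_sum fun k _ => by linarith [hstep k]
      _ = V 0 - V K := Finset.sum_range_sub' V K
      _ ≤ B := hV K
      _ = ∑ _k ∈ Finset.range K, B / K := by
        rw [Finset.sum_const, Finset.card_range, nsmul_eq_mul, mul_div_cancel₀ _ hK0.ne']
  obtain ⟨k, hk, hle⟩ :=
    Finset.exists_le_of_sum_le (Finset.nonempty_range_iff.2 (by omega)) hsum
  refine ⟨k, Finset.mem_range.1 hk, ?_⟩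
  rw [mul_comm c, ← div_div]
  exact (le_div_iff₀' hc).2 hle

theorem norm_inexact_step_sub_le {E : Type*} [SeminormedAddCommGroup E] {z v v₀ z₀ : E} {ρ : ℝ}
    (hρ : 0 ≤ ρ) (hv : ‖v - v₀‖ ≤ ρ * ‖v₀‖) :
    ‖z - v - z₀‖ ≤ (1 + ρ) * ‖z - v₀ - z₀‖ + ρ * ‖z - z₀‖ := by
  have hv₀ : ‖v₀‖ ≤ ‖z - z₀‖ + ‖z - v₀ - z₀‖ := by
    have hdiff := norm_sub_le (z - z₀) (z - v₀ - z₀)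
    rwa [show z - z₀ - (z - v₀ - z₀) = v₀ by abel] at hdiff
  calc ‖z - v - z₀‖ = ‖(z - v₀ - z₀) - (v - v₀)‖ := by congr 1; abel
    _ ≤ ‖z - v₀ - z₀‖ + ρ * (‖z - z₀‖ + ‖z - v₀ - z₀‖) :=
      norm_sub_le_of_le le_rfl (hv.trans (by gcongr))
    _ = (1 + ρ) * ‖z - v₀ - z₀‖ + ρ * ‖z - z₀‖ := by ring

theorem val_nboStep {m n : ℕ} (f g : Joint m n → ℝ) (α : ℝ) (T : ℕ) (s : Iterate m n) :
    (nboStep f g α T s).val =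
      ⟨s.x - α • direction f g s.x s.y s.u,
        s.y - (cg (askHess g s.x s.y) (grad2 g s.x s.y) T).val,
        s.u - (cg (askHess g s.x s.y) (hess22 g s.x s.y s.u - grad2 f s.x s.y) T).val⟩ :=
  rfl

theorem val_nboCG_succ {m n : ℕ} (f g : Joint m n → ℝ) (α : ℝ) (T : ℕ) (s : Iterate m n) (k : ℕ) :
    (nboCG f g α T s (k + 1)).val = (nboStep f g α T (nboCG f g α T s k).val).val := by
  rw [nboCG, val_bind]

/-- The radius of the set of admissible `y`, in terms of `L₁ = L_{f,1} + L_{g,2} L_{f,0} / μ`. -/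
def yRadius (μ Lg2 L1 : ℝ) : ℝ := min (μ / (2 * Lg2)) (1 / (2 * √L1))

/-- The radius of the set of admissible `u`, in terms of `L₁ = L_{f,1} + L_{g,2} L_{f,0} / μ`. -/
def uRadius (μ Lg2 L1 : ℝ) : ℝ := min (5 * L1 / (2 * Lg2)) (√L1 / μ)

/-- The weighted error of an iterate. The weight of `y` makes the coupling of the error of `u` to
that of `y` negligible, so that the weighted error contracts as a whole. -/
def weightedError {m n : ℕ} (f g : Joint m n → ℝ) (Lg1 L1 κ : ℝ) (s : Iterate m n) : ℝ :=
  4 * κ * L1 * ‖s.y - yStar g s.x‖ + Lg1 * ‖s.u - uStar f g s.x‖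

/-- The function decreasing along NBO-CG: the objective plus a multiple of the squared
weighted error. -/
def lyapunov {m n : ℕ} (f g : Joint m n → ℝ) (Lg1 L1 κ α : ℝ) (s : Iterate m n) : ℝ :=
  Phi f g s.x + 5 / 2 * α * weightedError f g Lg1 L1 κ s ^ 2

/-- A bound for the norm of the direction at admissible points, in terms of
`L₁ = L_{f,1} + L_{g,2} L_{f,0} / μ`. -/
def directionBound (μ Lg1 Lg2 Lf0 Cf0 L1 : ℝ) : ℝ := Cf0 + Lg1 * (Lf0 / μ + 5 * L1 / (2 * Lg2))

/-- The requirements on the constants of the problem, the condition number `κ`, the step size `α`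
and the number `T` of inner iterations under which NBO-CG converges. The field `drift_le` bounds
the distance by which `y*(x)` moves in one step from an admissible point. -/
structure StepConditions (μ Lf1 Lg1 Lg2 Lf0 Cf0 L1 κ α : ℝ) (T : ℕ) : Prop where
  μ_pos : 0 < μ
  Lf1_pos : 0 < Lf1
  Lg1_nonneg : 0 ≤ Lg1
  Lg2_pos : 0 < Lg2
  Lf0_nonneg : 0 ≤ Lf0
  L1_eq : L1 = Lf1 + Lg2 * (Lf0 / μ)
  one_le : 1 ≤ κ
  Lg1_le : Lg1 ≤ κ * μ
  α_pos : 0 < α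
  inner_iterations : 4 * (√κ * (1 + Real.log κ)) ≤ T
  drift_le : κ * (α * directionBound μ Lg1 Lg2 Lf0 Cf0 L1) ≤ yRadius μ Lg2 L1 / 4
  contract : 60 * (κ ^ 2 * L1 * α) ≤ 1

theorem L1_div_mul_yRadius_le {μ Lg2 L1 : ℝ} (hμ : 0 < μ) (hLg2 : 0 < Lg2) (hL1 : 0 < L1) :
    L1 / μ * yRadius μ Lg2 L1 ≤ uRadius μ Lg2 L1 / 2 := by
  rw [yRadius, uRadius, mul_min_of_nonneg _ _ (by positivity),
    ← min_div_div_right (zero_le_two (α := ℝ))]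
  refine min_le_min ?_ (le_of_eq ?_)
  · rw [show L1 / μ * (μ / (2 * Lg2)) = L1 / (2 * Lg2) by field_simp,
      show 5 * L1 / (2 * Lg2) / 2 = 5 / 2 * (L1 / (2 * Lg2)) by ring]
    linarith [show 0 ≤ L1 / (2 * Lg2) by positivity]
  · have : 0 < √L1 := Real.sqrt_pos.2 hL1
    calc L1 / μ * (1 / (2 * √L1)) = √L1 * √L1 / μ * (1 / (2 * √L1)) := by
          rw [Real.mul_self_sqrt hL1.le]
      _ = √L1 / μ / 2 := by field_simp

section Step

variable {m n : ℕ} {f g : Joint m n → ℝ} {μ Lf1 Lg1 Lg2 Lf0 Cf0 L1 κ α : ℝ} {T : ℕ}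

namespace StepConditions

variable (hS : StepConditions μ Lf1 Lg1 Lg2 Lf0 Cf0 L1 κ α T)
include hS

theorem κ_pos : 0 < κ := one_pos.trans_le hS.one_le

theorem Lg1_div_le : Lg1 / μ ≤ κ := (div_le_iff₀ hS.μ_pos).2 hS.Lg1_le

theorem L1_pos : 0 < L1 := by
  have := hS.μ_pos
  have := hS.Lf1_pos
  have := hS.Lg2_pos
  have := hS.Lf0_nonneg
  rw [hS.L1_eq]
  positivity

theorem mem_box_iff (s : Iterate m n) : s ∈ box f g μ Lf1 Lg2 Lf0 ↔
    ‖s.y - yStar g s.x‖ ≤ yRadius μ Lg2 L1 ∧ ‖s.u - uStar f g s.x‖ ≤ uRadius μ Lg2 L1 := by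
  rw [hS.L1_eq]
  rfl

theorem weightedError_nonneg (s : Iterate m n) : 0 ≤ weightedError f g Lg1 L1 κ s := by
  have := hS.L1_pos
  have := hS.κ_pos
  have := hS.Lg1_nonneg
  unfold weightedError
  positivity

theorem weightedError_le {s : Iterate m n} (hs : s ∈ box f g μ Lf1 Lg2 Lf0) :
    weightedError f g Lg1 L1 κ s ≤ 3 * (κ * √L1) := by
  obtain ⟨hy, hu⟩ := (hS.mem_box_iff s).1 hs
  have := hS.μ_pos
  have := hS.κ_pos
  have hL1 := hS.L1_pos
  have : 0 < √L1 := Real.sqrt_pos.2 hL1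
  calc weightedError f g Lg1 L1 κ s
      ≤ 4 * κ * L1 * (1 / (2 * √L1)) + κ * μ * (√L1 / μ) := by
        unfold weightedError
        gcongr
        · exact hy.trans (min_le_right _ _)
        · exact hS.Lg1_le
        · exact hu.trans (min_le_right _ _)
    _ = 4 * κ * (√L1 * √L1) * (1 / (2 * √L1)) + κ * μ * (√L1 / μ) := by
      rw [Real.mul_self_sqrt hL1.le]
    _ = 3 * (κ * √L1) := by field_simp; ring

theorem lyapunov_le {s : Iterate m n} (hs : s ∈ box f g μ Lf1 Lg2 Lf0) :
    lyapunov f g Lg1 L1 κ α s ≤ Phi f g s.x + 2 := by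
  have := hS.α_pos
  have := hS.weightedError_nonneg (f := f) (g := g) s
  refine add_le_add_right ?_ _
  calc 5 / 2 * α * weightedError f g Lg1 L1 κ s ^ 2
      ≤ 5 / 2 * α * (3 * (κ * √L1)) ^ 2 := by
        gcongr
        exact hS.weightedError_le hs
    _ = 45 / 2 * (κ ^ 2 * L1 * α) := by rw [mul_pow, mul_pow, Real.sq_sqrt hS.L1_pos.le]; ring
    _ ≤ 2 := by linarith [hS.contract]

theorem Phi_le_lyapunov (s : Iterate m n) : Phi f g s.x ≤ lyapunov f g Lg1 L1 κ α s :=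
  le_add_of_nonneg_right (mul_nonneg (by linarith [hS.α_pos]) (sq_nonneg _))

end StepConditions

namespace Assumptions

variable (hA : Assumptions f g μ Lf1 Lg1 Lg2 Lf0 Cf0)
  (hS : StepConditions μ Lf1 Lg1 Lg2 Lf0 Cf0 L1 κ α T)
include hA hS

theorem norm_cg_sub_le (x : Vec m) (y : Vec n) {b v : Vec n} (hv : hess22 g x y v = b) :
    ‖(cg (askHess g x y) b T).val - v‖ ≤ 1 / 10 * ‖v‖ :=
  (norm_cg_sub_le_sqrt_mul_exp (hA.isSymmetric_hess x y) hS.μ_pos (hA.mul_norm_sq_le_inner_hess x y)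
    (fun _ => rfl) (hA.inner_hess_le hS.Lg1_nonneg x y) hS.one_le hS.Lg1_le hv T).trans <|
    mul_le_mul_of_nonneg_right (sqrt_mul_two_mul_exp_le hS.one_le hS.inner_iterations)
      (norm_nonneg v)

theorem norm_yStar_move_le (x d : Vec m) :
    ‖yStar g x - yStar g (x - α • d)‖ ≤ κ * (α * ‖d‖) := by
  have := hS.α_pos
  have hlip := hA.norm_yStar_sub_le hS.μ_pos x (x - α • d)
  rw [sub_sub_cancel, norm_smul, Real.norm_of_nonneg hS.α_pos.le] at hlip
  exact hlip.trans (by gcongr; exact hS.Lg1_div_le)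

theorem norm_uStar_move_le (x d : Vec m) :
    ‖uStar f g x - uStar f g (x - α • d)‖ ≤ L1 / μ * (2 * κ) * (α * ‖d‖) := by
  have := hS.α_pos
  have := hS.L1_pos
  have := hS.μ_pos
  have hlip := hA.norm_uStar_sub_le hS.μ_pos hS.Lf1_pos.le hS.Lg2_pos.le hS.Lf0_nonneg x
    (x - α • d)
  rw [sub_sub_cancel, norm_smul, Real.norm_of_nonneg hS.α_pos.le, ← hS.L1_eq, ← mul_assoc] at hlip
  exact hlip.trans (by gcongr; linarith [hS.one_le, hS.Lg1_div_le])

theorem norm_newton_sub_le_div_four {x : Vec m} {y v : Vec n} (hv : hess22 g x y v = grad2 g x y)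
    (hy : ‖y - yStar g x‖ ≤ μ / (2 * Lg2)) :
    ‖y - v - yStar g x‖ ≤ ‖y - yStar g x‖ / 4 := by
  have := hS.μ_pos
  have := hS.Lg2_pos
  calc ‖y - v - yStar g x‖ ≤ Lg2 / (2 * μ) * ‖y - yStar g x‖ ^ 2 :=
        hA.norm_newton_sub_le hS.μ_pos x y v hv
    _ = Lg2 / (2 * μ) * ‖y - yStar g x‖ * ‖y - yStar g x‖ := by ring
    _ ≤ Lg2 / (2 * μ) * (μ / (2 * Lg2)) * ‖y - yStar g x‖ := by gcongr
    _ = ‖y - yStar g x‖ / 4 := by field_simp; ring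

theorem norm_nboStep_y_sub_le {s : Iterate m n} (hy : ‖s.y - yStar g s.x‖ ≤ μ / (2 * Lg2)) :
    ‖(nboStep f g α T s).val.y - yStar g (nboStep f g α T s).val.x‖ ≤
      ‖s.y - yStar g s.x‖ / 2 + κ * (α * ‖direction f g s.x s.y s.u‖) := by
  rw [val_nboStep]
  obtain ⟨v₀, hv₀⟩ := hA.exists_hess_eq hS.μ_pos s.x s.y (grad2 g s.x s.y)
  have hnewton := hA.norm_newton_sub_le_div_four hS hv₀ hy
  have hinexact := norm_inexact_step_sub_le (z := s.y) (z₀ := yStar g s.x) (by norm_num)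
    (hA.norm_cg_sub_le hS s.x s.y hv₀)
  refine (norm_sub_le_norm_sub_add_norm_sub _ (yStar g s.x) _).trans
    (add_le_add ?_ (hA.norm_yStar_move_le hS _ _))
  linarith [norm_nonneg (s.y - yStar g s.x)]

theorem norm_nboStep_u_sub_le (s : Iterate m n) :
    ‖(nboStep f g α T s).val.u - uStar f g (nboStep f g α T s).val.x‖ ≤
      11 / 10 * (L1 / μ * ‖s.y - yStar g s.x‖) + 1 / 10 * ‖s.u - uStar f g s.x‖
        + L1 / μ * (2 * κ) * (α * ‖direction f g s.x s.y s.u‖) := by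
  rw [val_nboStep]
  obtain ⟨w₀, hw₀⟩ :=
    hA.exists_hess_eq hS.μ_pos s.x s.y (hess22 g s.x s.y s.u - grad2 f s.x s.y)
  have hexact := hA.norm_sub_uStar_le hS.μ_pos s.x s.x s.y (s.u - w₀)
    (by rw [map_sub, hw₀, sub_sub_cancel])
  rw [norm_pt_sub_right, ← hS.L1_eq] at hexact
  have hinexact := norm_inexact_step_sub_le (z := s.u) (z₀ := uStar f g s.x) (by norm_num)
    (hA.norm_cg_sub_le hS s.x s.y hw₀)
  refine (norm_sub_le_norm_sub_add_norm_sub _ (uStar f g s.x) _).trans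
    (add_le_add ?_ (hA.norm_uStar_move_le hS _ _))
  linarith

theorem nboStep_mem_box {s : Iterate m n} (hs : s ∈ box f g μ Lf1 Lg2 Lf0) :
    (nboStep f g α T s).val ∈ box f g μ Lf1 Lg2 Lf0 := by
  obtain ⟨hy, hu⟩ := (hS.mem_box_iff s).1 hs
  have := hS.α_pos
  have := hS.κ_pos
  have := hS.μ_pos
  have hL1 := hS.L1_pos
  have hdir : ‖direction f g s.x s.y s.u‖ ≤ directionBound μ Lg1 Lg2 Lf0 Cf0 L1 :=
    hA.norm_direction_le hS.μ_pos hS.Lg1_nonneg s.x s.y (hu.trans (min_le_left _ _))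
  have hcoupling := L1_div_mul_yRadius_le hS.μ_pos hS.Lg2_pos hL1
  have herror : L1 / μ * ‖s.y - yStar g s.x‖ ≤ L1 / μ * yRadius μ Lg2 L1 := by gcongr
  have hdrift_y : κ * (α * ‖direction f g s.x s.y s.u‖) ≤ yRadius μ Lg2 L1 / 4 :=
    le_trans (by gcongr) hS.drift_le
  have hdrift_u : L1 / μ * (2 * κ) * (α * ‖direction f g s.x s.y s.u‖)
      ≤ L1 / μ * yRadius μ Lg2 L1 / 2 :=
    calc _ = L1 / μ * 2 * (κ * (α * ‖direction f g s.x s.y s.u‖)) := by ring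
      _ ≤ L1 / μ * 2 * (yRadius μ Lg2 L1 / 4) := by gcongr
      _ = L1 / μ * yRadius μ Lg2 L1 / 2 := by ring
  refine (hS.mem_box_iff _).2 ⟨?_, ?_⟩
  · linarith [hA.norm_nboStep_y_sub_le hS (hy.trans (min_le_left _ _)),
      (norm_nonneg _).trans hy]
  · linarith [hA.norm_nboStep_u_sub_le hS s, (norm_nonneg _).trans hu]

theorem nboCG_mem_box {s : Iterate m n} (hs : s ∈ box f g μ Lf1 Lg2 Lf0) (k : ℕ) :
    (nboCG f g α T s k).val ∈ box f g μ Lf1 Lg2 Lf0 := by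
  induction k with
  | zero => exact hs
  | succ k ih =>
    rw [val_nboCG_succ]
    exact hA.nboStep_mem_box hS ih

theorem weightedError_nboStep_le {s : Iterate m n} (hs : s ∈ box f g μ Lf1 Lg2 Lf0) :
    weightedError f g Lg1 L1 κ (nboStep f g α T s).val ≤
      4 / 5 * weightedError f g Lg1 L1 κ s + 1 / 10 * ‖direction f g s.x s.y s.u‖ := by
  have hy := hA.norm_nboStep_y_sub_le hS (((hS.mem_box_iff s).1 hs).1.trans (min_le_left _ _))
  have hu := hA.norm_nboStep_u_sub_le hS s
  have := hS.α_pos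
  have := hS.κ_pos
  have := hS.Lg1_nonneg
  have := hS.L1_pos
  unfold weightedError
  set P := ‖s.y - yStar g s.x‖
  set U := ‖s.u - uStar f g s.x‖
  set d := ‖direction f g s.x s.y s.u‖
  have : 0 ≤ P := norm_nonneg _
  have hweight : Lg1 * (L1 / μ) ≤ κ * L1 := by
    rw [mul_div_left_comm, mul_comm κ]
    gcongr
    exact hS.Lg1_div_le
  have hdrift : 6 * (κ ^ 2 * L1 * α) * d ≤ 1 / 10 * d := by
    gcongr
    linarith [hS.contract]
  have hP : 0 ≤ κ * L1 * P := by positivity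
  have hU : 0 ≤ Lg1 * U := by positivity
  calc _ ≤ 4 * κ * L1 * (P / 2 + κ * (α * d))
        + Lg1 * (11 / 10 * (L1 / μ * P) + 1 / 10 * U + L1 / μ * (2 * κ) * (α * d)) := by gcongr
    _ = 2 * κ * L1 * P + 4 * (κ ^ 2 * L1 * α) * d
        + (Lg1 * (L1 / μ)) * (11 / 10 * P + 2 * κ * (α * d)) + 1 / 10 * (Lg1 * U) := by ring
    _ ≤ 2 * κ * L1 * P + 4 * (κ ^ 2 * L1 * α) * d
        + (κ * L1) * (11 / 10 * P + 2 * κ * (α * d)) + 1 / 10 * (Lg1 * U) := by gcongr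
    _ = 31 / 10 * (κ * L1 * P) + 6 * (κ ^ 2 * L1 * α) * d + 1 / 10 * (Lg1 * U) := by ring
    _ ≤ 4 / 5 * (4 * κ * L1 * P + Lg1 * U) + 1 / 10 * d := by linarith

theorem norm_direction_sub_hypergradient_le_weightedError (s : Iterate m n) :
    ‖direction f g s.x s.y s.u - hypergradient f g s.x‖ ≤ weightedError f g Lg1 L1 κ s := by
  have herr := hA.norm_direction_sub_hypergradient_le hS.μ_pos hS.Lg1_nonneg s.x s.y s.u
  rw [← hS.L1_eq] at herr
  have := hS.L1_pos
  exact herr.trans (by unfold weightedError; gcongr; nlinarith [hS.one_le])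

theorem Phi_nboStep_le (s : Iterate m n) :
    Phi f g (nboStep f g α T s).val.x ≤ Phi f g s.x - α / 2 * ‖hypergradient f g s.x‖ ^ 2
      - α / 4 * ‖direction f g s.x s.y s.u‖ ^ 2 + α / 2 * weightedError f g Lg1 L1 κ s ^ 2 := by
  rw [val_nboStep]
  have hα := hS.α_pos
  have herr := hA.norm_direction_sub_hypergradient_le_weightedError hS s
  set d := direction f g s.x s.y s.u
  set G := hypergradient f g s.x
  have htaylor := (abs_le.1 (hA.abs_Phi_taylor_le hS.μ_pos hS.Lf1_pos.le hS.Lg2_pos.le hS.one_le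
    hS.Lg1_div_le s.x (-(α • d)))).2
  rw [← sub_eq_add_neg, inner_neg_right, inner_smul_right, norm_neg, norm_smul,
    Real.norm_of_nonneg hα.le, ← hS.L1_eq] at htaylor
  have hinner : α / 2 * (‖d‖ ^ 2 - 2 * ⟪G, d⟫_ℝ + ‖G‖ ^ 2)
      ≤ α / 2 * weightedError f g Lg1 L1 κ s ^ 2 := by
    rw [real_inner_comm, ← norm_sub_sq_real]
    gcongr
  have hcurvature : 3 * L1 * κ ^ 2 * (α * ‖d‖) ^ 2 ≤ α / 4 * ‖d‖ ^ 2 :=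
    calc _ = 3 * (κ ^ 2 * L1 * α) * (α * ‖d‖ ^ 2) := by ring
      _ ≤ 1 / 4 * (α * ‖d‖ ^ 2) := by gcongr; linarith [hS.contract]
      _ = α / 4 * ‖d‖ ^ 2 := by ring
  linarith

theorem lyapunov_nboStep_add_le {s : Iterate m n} (hs : s ∈ box f g μ Lf1 Lg2 Lf0) :
    lyapunov f g Lg1 L1 κ α (nboStep f g α T s).val + α / 2 * ‖hypergradient f g s.x‖ ^ 2
      ≤ lyapunov f g Lg1 L1 κ α s := by
  have hΦ := hA.Phi_nboStep_le hS s
  have herr := hA.weightedError_nboStep_le hS hs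
  have herr0 := hS.weightedError_nonneg (f := f) (g := g) (nboStep f g α T s).val
  unfold lyapunov
  set e := weightedError f g Lg1 L1 κ s
  set e' := weightedError f g Lg1 L1 κ (nboStep f g α T s).val
  set d := ‖direction f g s.x s.y s.u‖
  have := hS.α_pos
  have hsq : 5 / 2 * α * e' ^ 2 ≤ 5 / 2 * α * (4 / 5 * e ^ 2 + 1 / 20 * d ^ 2) := by
    gcongr
    calc e' ^ 2 ≤ (4 / 5 * e + 1 / 10 * d) ^ 2 := by gcongr
      _ ≤ 4 / 5 * e ^ 2 + 1 / 20 * d ^ 2 := by nlinarith [sq_nonneg (2 / 5 * e - 1 / 5 * d)]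
  have hd : 0 ≤ α * d ^ 2 := by positivity
  linarith

theorem minGradLE_nboCG (hbdd : BddBelow (range (Phi f g))) {s : Iterate m n}
    (hs : s ∈ box f g μ Lf1 Lg2 Lf0) {K : ℕ} (hK : 1 ≤ K) :
    minGradLE f g α T s K ((2 * Phi f g s.x - 2 * PhiStar f g + 4) / (α * K)) := by
  have hgrad : gradient (Phi f g) = hypergradient f g :=
    gradient_eq fun x => hA.hasGradientAt_Phi hS.μ_pos hS.Lf1_pos.le hS.Lg2_pos.le x
  obtain ⟨k, hk, hle⟩ := exists_lt_le_div_of_add_le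
    (V := fun k => lyapunov f g Lg1 L1 κ α (nboCG f g α T s k).val)
    (G := fun k => ‖hypergradient f g (nboCG f g α T s k).val.x‖ ^ 2)
    (B := Phi f g s.x + 2 - PhiStar f g) (half_pos hS.α_pos)
    (fun k => val_nboCG_succ f g α T s k ▸
      hA.lyapunov_nboStep_add_le hS (hA.nboCG_mem_box hS hs k))
    (fun k => sub_le_sub (hS.lyapunov_le hs)
      ((ciInf_le hbdd _).trans (hS.Phi_le_lyapunov (nboCG f g α T s k).val))) hK
  refine ⟨k, hk, hgrad ▸ hle.trans_eq ?_⟩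
  rw [show α / 2 * K = α * K / 2 by ring, div_div_eq_mul_div]
  ring

end Assumptions

end Step

/-! ### Oracle costs -/

theorem cost_bind {A B : Type} (c : Counted A) (k : A → Counted B) :
    (c >>= k).cost = ⟨c.cost.grad + (k c.val).cost.grad, c.cost.jac + (k c.val).cost.jac,
      c.cost.hess + (k c.val).cost.hess⟩ :=
  rfl

theorem cost_pure {A : Type} (x : A) : (pure x : Counted A).cost = ⟨0, 0, 0⟩ := rfl

section Costs

variable {m n : ℕ}

section ConjugateGradient

variable {O : Vec n → Counted (Vec n)} (hO : ∀ v, (O v).cost = ⟨0, 0, 1⟩)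
include hO

theorem cost_cgStep_le (s : CGState n) :
    (cgStep O s).cost.grad = 0 ∧ (cgStep O s).cost.jac = 0 ∧ (cgStep O s).cost.hess ≤ 1 := by
  unfold cgStep
  split_ifs
  · simp [cost_pure]
  · simp [cost_bind, cost_pure, hO]

theorem cost_cgIter_le (s : CGState n) (N : ℕ) :
    (cgIter O s N).cost.grad = 0 ∧ (cgIter O s N).cost.jac = 0 ∧
      (cgIter O s N).cost.hess ≤ N := by
  induction N with
  | zero => simp [cgIter, cost_pure]
  | succ N ih =>
    have hstep := cost_cgStep_le hO (cgIter O s N).val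
    simp only [cgIter, cost_bind]
    omega

theorem cost_cg_le (b : Vec n) (T : ℕ) :
    (cg O b T).cost.grad = 0 ∧ (cg O b T).cost.jac = 0 ∧ (cg O b T).cost.hess ≤ T + 1 :=
  cost_cgIter_le hO ⟨0, b, b⟩ (T + 1)

end ConjugateGradient

variable (f g : Joint m n → ℝ)

theorem cost_nboStep_le (α : ℝ) (T : ℕ) (s : Iterate m n) :
    (nboStep f g α T s).cost.grad = 3 ∧ (nboStep f g α T s).cost.jac = 1 ∧
      (nboStep f g α T s).cost.hess ≤ 2 * T + 3 := by
  have hcg := fun b => cost_cg_le (O := askHess g s.x s.y) (fun _ => rfl) b T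
  have hnewton := hcg (grad2 g s.x s.y)
  have hlinear := hcg (hess22 g s.x s.y s.u - grad2 f s.x s.y)
  simp only [nboStep, cost_bind, cost_pure, askGrad1, askGrad2, askHess, askJac]
  omega

theorem cost_nboCG_le (α : ℝ) (T : ℕ) (s : Iterate m n) (K : ℕ) :
    (nboCG f g α T s K).cost.grad = 3 * K ∧ (nboCG f g α T s K).cost.jac = K ∧
      (nboCG f g α T s K).cost.hess ≤ (2 * T + 3) * K := by
  induction K with
  | zero => simp [nboCG, cost_pure]
  | succ K ih =>
    have hstep := cost_nboStep_le f g α T (nboCG f g α T s K).val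
    simp only [nboCG, cost_bind, mul_add, mul_one]
    omega

theorem cost_initY (β : ℝ) (x : Vec m) (y : Vec n) (N : ℕ) :
    (initY g β x y N).cost = ⟨N, 0, 0⟩ := by
  induction N with
  | zero => rfl
  | succ N ih => simp [initY, cost_bind, cost_pure, ih, askGrad2]

theorem cost_initU (β : ℝ) (x : Vec m) (y b u : Vec n) (Q : ℕ) :
    (initU g β x y b u Q).cost = ⟨0, 0, Q⟩ := by
  induction Q with
  | zero => rfl
  | succ Q ih => simp [initU, cost_bind, cost_pure, ih, askHess]

theorem cost_initBox (β : ℝ) (N Q : ℕ) (s : Iterate m n) :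
    (initBox f g β N Q s).cost = ⟨N + 1, 0, Q⟩ := by
  simp [initBox, cost_bind, cost_pure, cost_initY, cost_initU, askGrad2]

theorem cost_fullNboCG_le (β : ℝ) (N Q : ℕ) (α : ℝ) (T : ℕ) (s : Iterate m n) (K : ℕ) :
    (fullNboCG f g β N Q α T s K).cost.grad = N + 1 + 3 * K ∧
      (fullNboCG f g β N Q α T s K).cost.jac = K ∧
      (fullNboCG f g β N Q α T s K).cost.hess ≤ Q + (2 * T + 3) * K := by
  have hnbo := cost_nboCG_le f g α T (initBox f g β N Q s).val K
  simp only [fullNboCG, cost_bind, cost_initBox]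
  omega

end Costs

/-! ### The initialization -/

section GradientDescent

variable {m n : ℕ} {f g : Joint m n → ℝ} {μ Lf1 Lg1 Lg2 Lf0 Cf0 β : ℝ}

theorem mul_le_one_of_le_one_div {L : ℝ} (hL : 0 < L) (hβ0 : 0 ≤ β) (hβ : β ≤ 1 / L)
    (hμL : μ ≤ L) : β * μ ≤ 1 :=
  (mul_le_mul_of_nonneg_left hμL hβ0).trans ((le_div_iff₀ hL).1 hβ)

namespace Assumptions

variable (hA : Assumptions f g μ Lf1 Lg1 Lg2 Lf0 Cf0) (hμ : 0 < μ) (hμL : μ ≤ Lg1)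
  (hβ0 : 0 < β) (hβ : β ≤ 1 / Lg1)
include hA hμ hμL hβ0 hβ

theorem norm_initY_sub_sq_le (x : Vec m) (y : Vec n) (N : ℕ) :
    ‖(initY g β x y N).val - yStar g x‖ ^ 2 ≤ (1 - β * μ) ^ N * ‖y - yStar g x‖ ^ 2 := by
  have hL : 0 < Lg1 := hμ.trans_le hμL
  have : 0 ≤ 1 - β * μ := sub_nonneg.2 (mul_le_one_of_le_one_div hL hβ0.le hβ hμL)
  have hlip : ∀ y z, ‖grad2 g x y - grad2 g x z‖ ≤ Lg1 * ‖y - z‖ := fun y z => by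
    simpa only [norm_pt_sub_right] using norm_grad2_sub_le hA.g_grad_lip x x y z
  induction N with
  | zero => simp [initY, val_pure]
  | succ N ih =>
    calc _ ≤ (1 - β * μ) * ‖(initY g β x y N).val - yStar g x‖ ^ 2 :=
          norm_gradient_step_sub_sq_le hL (hA.g_strong x) (hA.hasGradientAt_g x) hlip hβ0 hβ
            (hA.yStar_le hμ x) _
      _ ≤ (1 - β * μ) * ((1 - β * μ) ^ N * ‖y - yStar g x‖ ^ 2) := by gcongr
      _ = (1 - β * μ) ^ (N + 1) * ‖y - yStar g x‖ ^ 2 := by ring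

theorem norm_initU_sub_le (x : Vec m) (y u : Vec n) {b v : Vec n} (hv : hess22 g x y v = b)
    (Q : ℕ) : ‖(initU g β x y b u Q).val - v‖ ≤ (1 - β * μ) ^ Q * ‖u - v‖ := by
  have hL : 0 < Lg1 := hμ.trans_le hμL
  have : 0 ≤ 1 - β * μ := sub_nonneg.2 (mul_le_one_of_le_one_div hL hβ0.le hβ hμL)
  induction Q with
  | zero => simp [initU, val_pure]
  | succ Q ih =>
    set w := (initU g β x y b u Q).val
    have hval : (initU g β x y b u (Q + 1)).val - v = (w - v) - β • hess22 g x y (w - v) := by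
      rw [map_sub, hv, sub_right_comm]
      rfl
    calc _ ≤ (1 - β * μ) * ‖w - v‖ := hval ▸
          norm_sub_smul_apply_le (hA.isSymmetric_hess x y) (hA.mul_norm_sq_le_inner_hess x y)
            (hA.inner_hess_le hL.le x y) hβ0.le ((le_div_iff₀ hL).1 hβ) (w - v)
      _ ≤ (1 - β * μ) * ((1 - β * μ) ^ Q * ‖u - v‖) := by gcongr
      _ = (1 - β * μ) ^ (Q + 1) * ‖u - v‖ := by ring

end Assumptions

end GradientDescent

/-- The number of iterations in which a process contracting by the factor `1 - ρ` reduces an error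
of size `w` to `κ⁻ᵖ`. The summand `w` replaces `log w`, which suffices for the order in `κ`. -/
def contractionSteps (ρ κ w : ℝ) (p : ℕ) : ℕ := ⌈(p * Real.log κ + w) / ρ⌉₊

theorem one_sub_pow_contractionSteps_mul_le {ρ κ w : ℝ} (hρ0 : 0 < ρ) (hρ1 : ρ ≤ 1) (hκ : 0 < κ)
    (hw : 0 ≤ w) (p : ℕ) : (1 - ρ) ^ contractionSteps ρ κ w p * w ≤ (κ ^ p)⁻¹ := by
  set N := contractionSteps ρ κ w p
  have : 0 ≤ 1 - ρ := sub_nonneg.2 hρ1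
  have hN : p * Real.log κ + w ≤ N * ρ := (div_le_iff₀ hρ0).1 (Nat.le_ceil _)
  have hexp : Real.exp (-w) * w ≤ 1 := by
    rw [mul_comm]
    exact (Real.mul_exp_neg_le_exp_neg_one w).trans (Real.exp_le_one_iff.2 (by norm_num))
  calc (1 - ρ) ^ N * w ≤ Real.exp (-ρ) ^ N * w := by
        gcongr
        exact Real.one_sub_le_exp_neg ρ
    _ = Real.exp (-(N * ρ)) * w := by rw [← Real.exp_nat_mul, mul_neg]
    _ ≤ Real.exp (-(p * Real.log κ + w)) * w := by gcongr
    _ = (κ ^ p)⁻¹ * (Real.exp (-w) * w) := by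
      rw [neg_add, Real.exp_add, Real.exp_neg (p * _), Real.exp_nat_mul, Real.exp_log hκ, mul_assoc]
    _ ≤ (κ ^ p)⁻¹ := mul_le_of_le_one_right (by positivity) hexp

theorem contractionSteps_div_le {r κ w : ℝ} (hr : 0 < r) (hκ : 1 ≤ κ) (hw : 0 ≤ w) (p : ℕ) :
    (contractionSteps (r / κ) κ w p : ℝ) ≤ ((p + w) / r + 1) * (κ * (1 + Real.log κ)) := by
  have hlog : 0 ≤ Real.log κ := Real.log_nonneg hκ
  have : 0 < κ := one_pos.trans_le hκ
  have hone : 1 ≤ κ * (1 + Real.log κ) := one_le_mul_of_one_le_of_one_le hκ (by linarith)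
  calc (contractionSteps (r / κ) κ w p : ℝ) ≤ (p * Real.log κ + w) / (r / κ) + 1 :=
        (Nat.ceil_lt_add_one (by positivity)).le
    _ ≤ ((p + w) * (1 + Real.log κ)) / (r / κ) + κ * (1 + Real.log κ) := by
      gcongr
      linarith [p.cast_nonneg (α := ℝ), mul_nonneg hw hlog]
    _ = ((p + w) / r + 1) * (κ * (1 + Real.log κ)) := by field_simp

section AdmissiblePoint

variable {m n : ℕ} {f g : Joint m n → ℝ} {μ Lf1 Lg1 Lg2 Lf0 Cf0 β : ℝ}

namespace Assumptions

variable (hA : Assumptions f g μ Lf1 Lg1 Lg2 Lf0 Cf0) (hμ : 0 < μ)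
include hA hμ

section Distance

variable (hμL : μ ≤ Lg1) (hβ0 : 0 < β) (hβ : β ≤ 1 / Lg1) {κ W r : ℝ} (hκ : 0 < κ) (hr : 0 < r)
include hμL hβ0 hβ hκ hr

theorem norm_initY_contractionSteps_sub_le {x : Vec m} {y : Vec n}
    (hy : ‖y - yStar g x‖ ≤ κ * W) :
    ‖(initY g β x y (contractionSteps (β * μ) κ ((W / r) ^ 2) 4)).val - yStar g x‖ ≤ r / κ := by
  have hβμ : β * μ ≤ 1 := mul_le_one_of_le_one_div (hμ.trans_le hμL) hβ0.le hβ hμL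
  have hdecay := one_sub_pow_contractionSteps_mul_le (w := (W / r) ^ 2) (mul_pos hβ0 hμ) hβμ hκ
    (by positivity) 4
  refine le_of_sq_le_sq ((hA.norm_initY_sub_sq_le hμ hμL hβ0 hβ x y _).trans ?_) (by positivity)
  set N := contractionSteps (β * μ) κ ((W / r) ^ 2) 4
  have : 0 ≤ 1 - β * μ := sub_nonneg.2 hβμ
  calc (1 - β * μ) ^ N * ‖y - yStar g x‖ ^ 2 ≤ (1 - β * μ) ^ N * (κ * W) ^ 2 := by gcongr
    _ = (1 - β * μ) ^ N * (W / r) ^ 2 * (κ * r) ^ 2 := by field_simp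
    _ ≤ (κ ^ 4)⁻¹ * (κ * r) ^ 2 := by gcongr
    _ = (r / κ) ^ 2 := by field_simp

theorem norm_initU_contractionSteps_sub_le (hW : 0 ≤ W) {x : Vec m} {y u b v : Vec n}
    (hv : hess22 g x y v = b) (hu : ‖u - v‖ ≤ κ * W) :
    ‖(initU g β x y b u (contractionSteps (β * μ) κ (W / r) 1)).val - v‖ ≤ r := by
  have hβμ : β * μ ≤ 1 := mul_le_one_of_le_one_div (hμ.trans_le hμL) hβ0.le hβ hμL
  have hdecay := one_sub_pow_contractionSteps_mul_le (w := W / r) (mul_pos hβ0 hμ) hβμ hκ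
    (by positivity) 1
  refine (hA.norm_initU_sub_le hμ hμL hβ0 hβ x y u hv _).trans ?_
  set Q := contractionSteps (β * μ) κ (W / r) 1
  have : 0 ≤ 1 - β * μ := sub_nonneg.2 hβμ
  calc (1 - β * μ) ^ Q * ‖u - v‖ ≤ (1 - β * μ) ^ Q * (κ * W) := by gcongr
    _ = (1 - β * μ) ^ Q * (W / r) * (κ * r) := by field_simp
    _ ≤ (κ ^ 1)⁻¹ * (κ * r) := by gcongr
    _ = r := by field_simp

end Distance

variable {L1 : ℝ} (hLg2 : 0 < Lg2) (hL1 : L1 = Lf1 + Lg2 * (Lf0 / μ)) (hL1pos : 0 < L1)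
  {x : Vec m} {y v : Vec n} (hv : hess22 g x y v = grad2 f x y)
  (hy : ‖y - yStar g x‖ ≤ yRadius μ Lg2 L1)
include hLg2 hL1 hL1pos hv hy

theorem norm_sub_uStar_le_half_uRadius : ‖v - uStar f g x‖ ≤ uRadius μ Lg2 L1 / 2 := by
  have hdist := hA.norm_sub_uStar_le hμ x x y v hv
  rw [norm_pt_sub_right, ← hL1] at hdist
  exact (hdist.trans (by gcongr)).trans (L1_div_mul_yRadius_le hμ hLg2 hL1pos)

theorem norm_sub_le_norm_add_of_hess_eq (u : Vec n) :
    ‖u - v‖ ≤ ‖u‖ + (Lf0 / μ + 5 * L1 / (2 * Lg2) / 2) := by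
  have hhalf := hA.norm_sub_uStar_le_half_uRadius hμ hLg2 hL1 hL1pos hv hy
  refine norm_sub_le_of_le le_rfl ?_
  calc ‖v‖ ≤ ‖uStar f g x‖ + ‖v - uStar f g x‖ := norm_le_insert' _ _
    _ ≤ Lf0 / μ + 5 * L1 / (2 * Lg2) / 2 := by
      gcongr
      · exact hA.norm_uStar_le hμ x
      · exact hhalf.trans (by gcongr; exact min_le_left _ _)

end Assumptions

end AdmissiblePoint

/-! ### The choice of the constants -/

section Constants

variable {M Lf1 Lg1 Lg2 Lf0 Cf0 κ : ℝ}

theorem le_L1 (hM : 0 ≤ M) (hLg2 : 0 ≤ Lg2) (hLf0 : 0 ≤ Lf0) (hκ : 0 ≤ κ) :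
    Lf1 ≤ Lf1 + Lg2 * (Lf0 / (M / κ)) :=
  le_add_of_nonneg_right (by positivity)

theorem L1_le_mul (hLf1 : 0 ≤ Lf1) (hκ : 1 ≤ κ) :
    Lf1 + Lg2 * (Lf0 / (M / κ)) ≤ (Lf1 + Lg2 * (Lf0 / M)) * κ := by
  rw [div_div_eq_mul_div, add_mul, mul_div_right_comm, mul_assoc]
  gcongr
  exact le_mul_of_one_le_right hLf1 hκ

section Comparison

variable {c L1 : ℝ} (hM : 0 < M) (hLg2 : 0 < Lg2) (hκ : 1 ≤ κ) (hL1 : 0 < L1) (hc : L1 ≤ c * κ)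
include hκ hc

theorem directionBound_div_le (hLg1 : 0 ≤ Lg1) (hLg2 : 0 ≤ Lg2) (hCf0 : 0 ≤ Cf0) :
    directionBound (M / κ) Lg1 Lg2 Lf0 Cf0 L1 ≤ directionBound M Lg1 Lg2 Lf0 Cf0 c * κ := by
  unfold directionBound
  calc Cf0 + Lg1 * (Lf0 / (M / κ) + 5 * L1 / (2 * Lg2))
      ≤ Cf0 * κ + Lg1 * (Lf0 * κ / M + 5 * (c * κ) / (2 * Lg2)) := by
        rw [div_div_eq_mul_div]
        gcongr
        exact le_mul_of_one_le_right hCf0 hκ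
    _ = (Cf0 + Lg1 * (Lf0 / M + 5 * c / (2 * Lg2))) * κ := by ring

include hL1

theorem yRadius_div_le : yRadius M Lg2 c / κ ≤ yRadius (M / κ) Lg2 L1 := by
  have hκ0 : 0 < κ := one_pos.trans_le hκ
  have hc0 : 0 < c := pos_of_mul_pos_left (hL1.trans_le hc) hκ0.le
  have : 0 < √L1 := Real.sqrt_pos.2 hL1
  have hsqrt : √L1 ≤ √c * κ := by
    refine Real.sqrt_le_iff.2 ⟨by positivity, hc.trans ?_⟩
    rw [mul_pow, Real.sq_sqrt hc0.le]
    gcongr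
    exact le_self_pow₀ hκ two_ne_zero
  unfold yRadius
  rw [← min_div_div_right hκ0.le]
  refine min_le_min (div_right_comm _ _ _).le ?_
  rw [div_div, mul_assoc]
  gcongr

include hM hLg2

theorem div_mul_yRadius_le_half_uRadius (hle : Lf1 ≤ L1) :
    Lf1 / M * yRadius M Lg2 c ≤ uRadius (M / κ) Lg2 L1 / 2 := by
  have : 0 < κ := one_pos.trans_le hκ
  have hr : 0 ≤ yRadius M Lg2 c := by unfold yRadius; positivity
  calc Lf1 / M * yRadius M Lg2 c ≤ L1 / M * yRadius M Lg2 c := by gcongr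
    _ = L1 / (M / κ) * (yRadius M Lg2 c / κ) := by field_simp
    _ ≤ L1 / (M / κ) * yRadius (M / κ) Lg2 L1 := by
      gcongr
      exact yRadius_div_le hκ hL1 hc
    _ ≤ uRadius (M / κ) Lg2 L1 / 2 := L1_div_mul_yRadius_le (by positivity) hLg2 hL1

end Comparison

theorem yRadius_pos {μ L1 : ℝ} (hμ : 0 < μ) (hLg2 : 0 < Lg2) (hL1 : 0 < L1) :
    0 < yRadius μ Lg2 L1 := by
  have : 0 < √L1 := Real.sqrt_pos.2 hL1
  unfold yRadius
  positivity

theorem exists_stepConditions (hM : Lg1 ≤ M) (hLf1 : 0 < Lf1) (hLg1 : 0 < Lg1) (hLg2 : 0 < Lg2)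
    (hLf0 : 0 ≤ Lf0) (hCf0 : 0 ≤ Cf0) :
    ∃ a : ℝ, 0 < a ∧ ∀ κ : ℝ, 1 ≤ κ → ∀ T : ℕ, 4 * (√κ * (1 + Real.log κ)) ≤ T →
      StepConditions (M / κ) Lf1 Lg1 Lg2 Lf0 Cf0 (Lf1 + Lg2 * (Lf0 / (M / κ))) κ (a / κ ^ 3) T := by
  have hM0 : 0 < M := hLg1.trans_le hM
  set c := Lf1 + Lg2 * (Lf0 / M)
  have hc : 0 < c := by positivity
  set r := yRadius M Lg2 c
  have hr : 0 < r := yRadius_pos hM0 hLg2 hc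
  set B := directionBound M Lg1 Lg2 Lf0 Cf0 c with hB
  have hB0 : 0 < B := by rw [hB, directionBound]; positivity
  set a := min (r / (4 * B)) (1 / (60 * c))
  have ha : 0 < a := by positivity
  have haB : a * B ≤ r / 4 :=
    calc a * B ≤ r / (4 * B) * B := by gcongr; exact min_le_left _ _
      _ = r / 4 := by field_simp
  have hac : a * c ≤ 1 / 60 :=
    calc a * c ≤ 1 / (60 * c) * c := by gcongr; exact min_le_right _ _
      _ = 1 / 60 := by field_simp
  refine ⟨a, ha, fun κ hκ T hT => ?_⟩
  have hκ0 : 0 < κ := one_pos.trans_le hκ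
  have hL1c : Lf1 + Lg2 * (Lf0 / (M / κ)) ≤ c * κ := L1_le_mul hLf1.le hκ
  have hL1 : 0 < Lf1 + Lg2 * (Lf0 / (M / κ)) :=
    hLf1.trans_le (le_L1 hM0.le hLg2.le hLf0 hκ0.le)
  refine ⟨by positivity, hLf1, hLg1.le, hLg2, hLf0, rfl, hκ, by rwa [mul_div_cancel₀ _ hκ0.ne'],
    by positivity, hT, ?_, ?_⟩
  · calc _ ≤ κ * (a / κ ^ 3 * (B * κ)) := by
          gcongr
          exact directionBound_div_le hκ hL1c hLg1.le hLg2.le hCf0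
      _ = a * B / κ := by field_simp
      _ ≤ r / 4 / κ := by gcongr
      _ = r / κ / 4 := div_right_comm _ _ _
      _ ≤ yRadius (M / κ) Lg2 (Lf1 + Lg2 * (Lf0 / (M / κ))) / 4 := by
        gcongr
        exact yRadius_div_le hκ hL1 hL1c
  · calc _ ≤ 60 * (κ ^ 2 * (c * κ) * (a / κ ^ 3)) := by gcongr
      _ = 60 * (a * c) := by field_simp
      _ ≤ 1 := by linarith

theorem Assumptions.initBox_mem_box {m n : ℕ} {f g : Joint m n → ℝ} {β R : ℝ}
    (hA : Assumptions f g (M / κ) Lf1 Lg1 Lg2 Lf0 Cf0) (hM : 0 < M) (hLf1 : 0 < Lf1)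
    (hLg2 : 0 < Lg2) (hLf0 : 0 ≤ Lf0) (hβ0 : 0 < β) (hβ : β ≤ 1 / Lg1) (hκ : 1 ≤ κ)
    (hμL : M / κ ≤ Lg1) {c r : ℝ} (hc : c = Lf1 + Lg2 * (Lf0 / M)) (hr : r = yRadius M Lg2 c)
    {s : Iterate m n} (hy : ‖grad2 g s.x s.y‖ ≤ R) (hu : ‖s.u‖ ≤ R) :
    (initBox f g β (contractionSteps (β * (M / κ)) κ ((R / M / r) ^ 2) 4)
      (contractionSteps (β * (M / κ)) κ
        ((R + (Lf0 / M + 5 * c / (2 * Lg2) / 2)) / (Lf1 / M * r)) 1) s).val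
      ∈ box f g (M / κ) Lf1 Lg2 Lf0 := by
  have hκ0 : 0 < κ := one_pos.trans_le hκ
  have hμ : 0 < M / κ := by positivity
  have hR : 0 ≤ R := (norm_nonneg _).trans hu
  have hc0 : 0 < c := by rw [hc]; positivity
  have hr0 : 0 < r := hr ▸ yRadius_pos hM hLg2 hc0
  obtain ⟨L1, hL1⟩ : ∃ L1, L1 = Lf1 + Lg2 * (Lf0 / (M / κ)) := ⟨_, rfl⟩
  have hle : Lf1 ≤ L1 := hL1 ▸ le_L1 hM.le hLg2.le hLf0 hκ0.le
  have hL1pos : 0 < L1 := hLf1.trans_le hle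
  have hL1c : L1 ≤ c * κ := hc ▸ hL1 ▸ L1_le_mul hLf1.le hκ
  have hyW : ‖s.y - yStar g s.x‖ ≤ κ * (R / M) := by
    have hdist := (hA.mul_norm_sub_yStar_le hμ s.x s.y).trans hy
    rw [← le_div_iff₀' hμ] at hdist
    exact hdist.trans_eq (by field_simp)
  have hyr := (hA.norm_initY_contractionSteps_sub_le hμ hμL hβ0 hβ hκ0 hr0 hyW).trans
    (hr ▸ yRadius_div_le hκ hL1pos hL1c)
  set y := (initY g β s.x s.y (contractionSteps (β * (M / κ)) κ ((R / M / r) ^ 2) 4)).val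
  obtain ⟨v, hv⟩ := hA.exists_hess_eq hμ s.x y (grad2 f s.x y)
  have huW : ‖s.u - v‖ ≤ κ * (R + (Lf0 / M + 5 * c / (2 * Lg2) / 2)) :=
    calc ‖s.u - v‖ ≤ ‖s.u‖ + (Lf0 / (M / κ) + 5 * L1 / (2 * Lg2) / 2) :=
          hA.norm_sub_le_norm_add_of_hess_eq hμ hLg2 hL1 hL1pos hv hyr s.u
      _ ≤ κ * R + (Lf0 * κ / M + 5 * (c * κ) / (2 * Lg2) / 2) := by
        rw [div_div_eq_mul_div]
        gcongr
        exact hu.trans (le_mul_of_one_le_left hR hκ)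
      _ = κ * (R + (Lf0 / M + 5 * c / (2 * Lg2) / 2)) := by ring
  have hur := hA.norm_initU_contractionSteps_sub_le hμ hμL hβ0 hβ hκ0
    (r := Lf1 / M * r) (by positivity) (by positivity) hv huW
  have hvu := hA.norm_sub_uStar_le_half_uRadius hμ hLg2 hL1 hL1pos hv hyr
  have hhalf : Lf1 / M * r ≤ uRadius (M / κ) Lg2 L1 / 2 :=
    hr ▸ div_mul_yRadius_le_half_uRadius hM hLg2 hκ hL1pos hL1c hle
  subst hL1
  exact ⟨hyr, (norm_sub_le_norm_sub_add_norm_sub _ v _).trans <|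
    (add_le_add (hur.trans hhalf) hvu).trans_eq (add_halves _)⟩

theorem exists_initBox_mem_box (hM : 0 < M) (hLf1 : 0 < Lf1) (hLg2 : 0 < Lg2) (hLf0 : 0 ≤ Lf0)
    (R : ℝ) {β : ℝ} (hβ0 : 0 < β) (hβ : β ≤ 1 / Lg1) :
    ∃ C : ℝ, 0 < C ∧ ∀ κ : ℝ, 1 ≤ κ → M / κ ≤ Lg1 →
      ∃ N Q : ℕ, (N : ℝ) ≤ C * (κ * (1 + Real.log κ)) ∧ (Q : ℝ) ≤ C * (κ * (1 + Real.log κ)) ∧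
      ∀ (m n : ℕ) (f g : Joint m n → ℝ), Assumptions f g (M / κ) Lf1 Lg1 Lg2 Lf0 Cf0 →
        ∀ s : Iterate m n, ‖grad2 g s.x s.y‖ ≤ R → ‖s.u‖ ≤ R →
          (initBox f g β N Q s).val ∈ box f g (M / κ) Lf1 Lg2 Lf0 := by
  obtain ⟨c, hc⟩ : ∃ c, c = Lf1 + Lg2 * (Lf0 / M) := ⟨_, rfl⟩
  have hc0 : 0 < c := by rw [hc]; positivity
  obtain ⟨r, hr⟩ : ∃ r, r = yRadius M Lg2 c := ⟨_, rfl⟩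
  have hr0 : 0 < r := hr ▸ yRadius_pos hM hLg2 hc0
  set wy := (|R| / M / r) ^ 2
  set wu := (|R| + (Lf0 / M + 5 * c / (2 * Lg2) / 2)) / (Lf1 / M * r)
  have hwy : 0 ≤ wy := by positivity
  have hwu : 0 ≤ wu := by positivity
  refine ⟨max (((4 : ℕ) + wy) / (β * M) + 1) (((1 : ℕ) + wu) / (β * M) + 1), by positivity,
    fun κ hκ hμL => ⟨contractionSteps (β * (M / κ)) κ wy 4, contractionSteps (β * (M / κ)) κ wu 1,
      ?_, ?_, fun m n f g hA s hy hu => hA.initBox_mem_box hM hLf1 hLg2 hLf0 hβ0 hβ hκ hμL hc hr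
        (hy.trans (le_abs_self R)) (hu.trans (le_abs_self R))⟩⟩
  all_goals
    have := Real.log_nonneg hκ
    have : 0 < κ := one_pos.trans_le hκ
    rw [← mul_div_assoc]
    refine (contractionSteps_div_le (mul_pos hβ0 hM) hκ ‹_› _).trans ?_
    gcongr
  exacts [le_max_left _ _, le_max_right _ _]

end Constants

/-! ### Complexity -/

theorem rpow_seven_halves {κ : ℝ} (hκ : 0 < κ) : κ ^ (7 / 2 : ℝ) = κ ^ 3 * √κ := by
  rw [Real.sqrt_eq_rpow, ← Real.rpow_natCast, ← Real.rpow_add hκ]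
  norm_num

theorem mul_one_add_log_le_cube_div {κ ε : ℝ} (hκ : 1 ≤ κ) (hε0 : 0 < ε) (hε1 : ε ≤ 1) :
    κ * (1 + Real.log κ) ≤ κ ^ 3 / ε := by
  have hκ0 : 0 < κ := one_pos.trans_le hκ
  calc κ * (1 + Real.log κ) ≤ κ * κ := by
        gcongr
        linarith [Real.log_le_sub_one_of_pos hκ0]
    _ = κ ^ 2 := (pow_two κ).symm
    _ ≤ κ ^ 3 := pow_le_pow_right₀ hκ (by norm_num)
    _ ≤ κ ^ 3 / ε := le_div_self (by positivity) hε0 hε1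

/-- The oracle complexity of the method: at most `C κ³ / ε` gradient computations and
Jacobian-vector products, and at most `C κ^{3.5} (1 + log κ) / ε` Hessian-vector products. -/
def CostLE (c : Cost) (C κ ε : ℝ) : Prop :=
  (c.grad : ℝ) ≤ C * (κ ^ 3 / ε) ∧ (c.jac : ℝ) ≤ C * (κ ^ 3 / ε) ∧
    (c.hess : ℝ) ≤ C * (κ ^ (7 / 2 : ℝ) * (1 + Real.log κ) / ε)

section Complexity

variable {B C C₀ κ ε : ℝ} {c : Cost} {N Q K T : ℕ}

theorem costLE_of_le (hB : 0 ≤ B) (hC₀ : 0 ≤ C₀) (hκ : 1 ≤ κ) (hε0 : 0 < ε) (hε1 : ε ≤ 1)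
    (hN : N ≤ C₀ * (κ * (1 + Real.log κ))) (hQ : Q ≤ C₀ * (κ * (1 + Real.log κ)))
    (hT : T ≤ 4 * (√κ * (1 + Real.log κ)) + 1) (hK : K ≤ B * (κ ^ 3 / ε))
    (hC : C₀ + 1 + 13 * B ≤ C) (hgrad : c.grad ≤ N + 1 + 3 * K) (hjac : c.jac ≤ K)
    (hhess : c.hess ≤ Q + (2 * T + 3) * K) : CostLE c C κ ε := by
  have hκ0 : 0 < κ := one_pos.trans_le hκ
  have hinit := mul_one_add_log_le_cube_div hκ hε0 hε1
  have hX : 1 ≤ κ ^ 3 / ε := (one_le_div hε0).2 (hε1.trans (one_le_pow₀ hκ))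
  have hY : 1 ≤ √κ * (1 + Real.log κ) :=
    one_le_mul_of_one_le_of_one_le (Real.one_le_sqrt.2 hκ) (by linarith [Real.log_nonneg hκ])
  have hXY : κ ^ (7 / 2 : ℝ) * (1 + Real.log κ) / ε = κ ^ 3 / ε * (√κ * (1 + Real.log κ)) := by
    rw [rpow_seven_halves hκ0]
    ring
  rw [CostLE, hXY]
  set X := κ ^ 3 / ε
  set Y := √κ * (1 + Real.log κ)
  refine ⟨?_, ?_, ?_⟩
  · calc (c.grad : ℝ) ≤ N + 1 + 3 * K := by exact_mod_cast hgrad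
      _ ≤ C₀ * X + X + 3 * (B * X) := by gcongr; exact hN.trans (by gcongr)
      _ = (C₀ + 1 + 3 * B) * X := by ring
      _ ≤ C * X := by gcongr; linarith
  · calc (c.jac : ℝ) ≤ K := by exact_mod_cast hjac
      _ ≤ B * X := hK
      _ ≤ C * X := by gcongr; linarith
  · calc (c.hess : ℝ) ≤ Q + (2 * T + 3) * K := by exact_mod_cast hhess
      _ ≤ C₀ * X + (13 * Y) * (B * X) := by
        gcongr
        · exact hQ.trans (by gcongr)
        · linarith
      _ ≤ C₀ * X * Y + (13 * Y) * (B * X) :=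
        add_le_add (le_mul_of_one_le_right (by positivity) hY) le_rfl
      _ = (C₀ + 13 * B) * (X * Y) := by ring
      _ ≤ C * (X * Y) := by gcongr; linarith

theorem exists_outer_iterations {a D : ℝ} (ha : 0 < a) (hD : 0 < D) (hκ : 1 ≤ κ) (hε0 : 0 < ε)
    (hε1 : ε ≤ 1) : ∃ K : ℕ, 1 ≤ K ∧ K ≤ (D / a + 1) * (κ ^ 3 / ε) ∧
      D / (a / κ ^ 3 * K) ≤ ε := by
  have : 0 < κ := one_pos.trans_le hκ
  have hX : 1 ≤ κ ^ 3 / ε := (one_le_div hε0).2 (hε1.trans (one_le_pow₀ hκ))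
  have hpos : 0 < D / a * (κ ^ 3 / ε) := by positivity
  refine ⟨⌈D / a * (κ ^ 3 / ε)⌉₊, Nat.one_le_ceil_iff.2 hpos, ?_, ?_⟩
  · linarith [Nat.ceil_lt_add_one hpos.le]
  · have : 0 < (⌈D / a * (κ ^ 3 / ε)⌉₊ : ℝ) := hpos.trans_le (Nat.le_ceil _)
    rw [div_le_iff₀ (by positivity)]
    calc D = ε * (a / κ ^ 3 * (D / a * (κ ^ 3 / ε))) := by field_simp
      _ ≤ ε * (a / κ ^ 3 * ⌈D / a * (κ ^ 3 / ε)⌉₊) := by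
        gcongr
        exact Nat.le_ceil _

end Complexity

section Rate

variable {m n : ℕ} {f g : Joint m n → ℝ} {μ Lf1 Lg1 Lg2 Lf0 Cf0 L1 κ α D : ℝ} {T : ℕ}

theorem minGradLE.mono {s : Iterate m n} {K : ℕ} {B B' : ℝ} (h : minGradLE f g α T s K B)
    (hB : B ≤ B') : minGradLE f g α T s K B' :=
  let ⟨k, hk, hle⟩ := h
  ⟨k, hk, hle.trans hB⟩

namespace Assumptions

variable (hA : Assumptions f g μ Lf1 Lg1 Lg2 Lf0 Cf0) (hbdd : BddBelow (range (Phi f g)))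
  {s : Iterate m n} (hs : s ∈ box f g μ Lf1 Lg2 Lf0) (hD : Phi f g s.x - PhiStar f g ≤ D)
include hA hbdd hs hD

theorem minGradLE_nboCG_of_sub_le (hS : StepConditions μ Lf1 Lg1 Lg2 Lf0 Cf0 L1 κ α T) {K : ℕ}
    (hK : 1 ≤ K) : minGradLE f g α T s K ((2 * D + 4) / (α * K)) := by
  have := hS.α_pos
  refine (hA.minGradLE_nboCG hS hbdd hs hK).mono ?_
  gcongr
  linarith

variable {a : ℝ} (hS : StepConditions μ Lf1 Lg1 Lg2 Lf0 Cf0 L1 κ (a / κ ^ 3) T)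
include hS

theorem minGradLE_nboCG_of_le {C : ℝ} (hC : (2 * D + 4) / a ≤ C) {K : ℕ} (hK : 1 ≤ K) :
    minGradLE f g (a / κ ^ 3) T s K (C * (κ ^ 3 / K)) := by
  have := hS.κ_pos
  refine (hA.minGradLE_nboCG_of_sub_le hbdd hs hD hS hK).mono ?_
  calc (2 * D + 4) / (a / κ ^ 3 * K) = (2 * D + 4) / a * (κ ^ 3 / K) := by field_simp
    _ ≤ C * (κ ^ 3 / K) := by gcongr

-- `c` stands for the cost of NBO-CG from `s`, preceded by the initialization unless `N = Q = 0`.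
theorem exists_minGradLE_and_costLE (ha : 0 < a) {C C₀ : ℝ} (hC₀ : 0 ≤ C₀)
    (hC : C₀ + 1 + 13 * ((2 * D + 4) / a + 1) ≤ C)
    (hT : T ≤ 4 * (√κ * (1 + Real.log κ)) + 1) {N Q : ℕ}
    (hN : N ≤ C₀ * (κ * (1 + Real.log κ))) (hQ : Q ≤ C₀ * (κ * (1 + Real.log κ)))
    {c : ℕ → Cost} (hc : ∀ K, (c K).grad ≤ N + 1 + 3 * K ∧ (c K).jac ≤ K ∧
      (c K).hess ≤ Q + (2 * T + 3) * K) {ε : ℝ} (hε0 : 0 < ε) (hε1 : ε ≤ 1) :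
    ∃ K : ℕ, 1 ≤ K ∧ K ≤ C * (κ ^ 3 / ε) ∧ minGradLE f g (a / κ ^ 3) T s K ε ∧
      CostLE (c K) C κ ε := by
  have := hS.κ_pos
  have hD0 : 0 ≤ D := (sub_nonneg.2 (ciInf_le hbdd s.x)).trans hD
  have hB : 0 < (2 * D + 4) / a + 1 := by positivity
  obtain ⟨K, hK1, hK, hrate⟩ := exists_outer_iterations ha (by linarith : 0 < 2 * D + 4)
    hS.one_le hε0 hε1
  obtain ⟨hgrad, hjac, hhess⟩ := hc K
  exact ⟨K, hK1, hK.trans (by gcongr; linarith),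
    (hA.minGradLE_nboCG_of_sub_le hbdd hs hD hS hK1).mono hrate,
    costLE_of_le hB.le hC₀ hS.one_le hε0 hε1 hN hQ hT hK hC hgrad hjac hhess⟩

end Assumptions

end Rate

end Bilevel

end

open Bilevel in
theorem mainTheorem3
    (Lf1 Lg1 Lg2 Lf0 Cf0 : ℝ) (hLf1 : 0 < Lf1) (hLg1 : 0 < Lg1) (hLg2 : 0 < Lg2)
    (hLf0 : 0 ≤ Lf0) (hCf0 : 0 ≤ Cf0) :
    ∃ a τ : ℝ, 0 < a ∧ 0 < τ ∧
    ∀ D R β : ℝ, 0 < β → β ≤ 1 / Lg1 →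
    ∃ C : ℝ, 0 < C ∧
    ∀ μ : ℝ, 0 < μ → μ ≤ Lg1 →
    ∀ κ : ℝ, κ = max Lg1 Lf1 / μ →
    ∀ α : ℝ, α = a / κ ^ 3 →
    ∀ T : ℕ, T = ⌈τ * (√κ * (1 + Real.log κ))⌉₊ →
    ∃ N Q : ℕ, (N : ℝ) ≤ C * (κ * (1 + Real.log κ)) ∧ (Q : ℝ) ≤ C * (κ * (1 + Real.log κ)) ∧
    ∀ (m n : ℕ) (f g : Joint m n → ℝ), Assumptions f g μ Lf1 Lg1 Lg2 Lf0 Cf0 →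
      BddBelow (Set.range (Phi f g)) →
      Differentiable ℝ (Phi f g) ∧
      -- convergence rate from every admissible initial point
      (∀ s ∈ box f g μ Lf1 Lg2 Lf0, ∀ K : ℕ, 1 ≤ K →
        minGradLE f g α T s K ((2 * Phi f g s.x - 2 * PhiStar f g + 4) / (α * K)) ∧
        (Phi f g s.x - PhiStar f g ≤ D → minGradLE f g α T s K (C * (κ ^ 3 / K)))) ∧
      -- complexity from every admissible initial point
      (∀ s ∈ box f g μ Lf1 Lg2 Lf0, Phi f g s.x - PhiStar f g ≤ D →
        ∀ ε : ℝ, 0 < ε → ε ≤ 1 → ∃ K : ℕ, 1 ≤ K ∧ (K : ℝ) ≤ C * (κ ^ 3 / ε) ∧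
          minGradLE f g α T s K ε ∧
          ((nboCG f g α T s K).cost.grad : ℝ) ≤ C * (κ ^ 3 / ε) ∧
          ((nboCG f g α T s K).cost.jac : ℝ) ≤ C * (κ ^ 3 / ε) ∧
          ((nboCG f g α T s K).cost.hess : ℝ) ≤
            C * (κ ^ (7 / 2 : ℝ) * (1 + Real.log κ) / ε)) ∧
      -- total complexity, with the computation of an admissible initial point included
      (∀ s : Iterate m n, ‖grad2 g s.x s.y‖ ≤ R → ‖s.u‖ ≤ R →
        (initBox f g β N Q s).val ∈ box f g μ Lf1 Lg2 Lf0 ∧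
        (Phi f g s.x - PhiStar f g ≤ D →
          ∀ ε : ℝ, 0 < ε → ε ≤ 1 → ∃ K : ℕ, 1 ≤ K ∧ (K : ℝ) ≤ C * (κ ^ 3 / ε) ∧
            minGradLE f g α T (initBox f g β N Q s).val K ε ∧
            ((fullNboCG f g β N Q α T s K).cost.grad : ℝ) ≤ C * (κ ^ 3 / ε) ∧
            ((fullNboCG f g β N Q α T s K).cost.jac : ℝ) ≤ C * (κ ^ 3 / ε) ∧
            ((fullNboCG f g β N Q α T s K).cost.hess : ℝ) ≤
              C * (κ ^ (7 / 2 : ℝ) * (1 + Real.log κ) / ε))) := by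
  have hM : 0 < max Lg1 Lf1 := lt_max_of_lt_left hLg1
  obtain ⟨a, ha, hstep⟩ := exists_stepConditions (le_max_left Lg1 Lf1) hLf1 hLg1 hLg2 hLf0 hCf0
  refine ⟨a, 4, ha, four_pos, fun D R β hβ0 hβ => ?_⟩
  obtain ⟨C₀, hC₀, hinit⟩ := exists_initBox_mem_box (Cf0 := Cf0) hM hLf1 hLg2 hLf0 R hβ0 hβ
  have hDa : 0 < (2 * |D| + 4) / a := by positivity
  obtain ⟨C, hC⟩ : ∃ C, C₀ + 1 + 13 * ((2 * |D| + 4) / a + 1) = C := ⟨_, rfl⟩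
  refine ⟨C, by linarith, ?_⟩
  rintro μ hμ hμL κ hκ _ rfl T hT
  have hκ1 : 1 ≤ κ := hκ ▸ (one_le_div hμ).2 (hμL.trans (le_max_left _ _))
  have hlog := Real.log_nonneg hκ1
  obtain rfl : μ = max Lg1 Lf1 / κ := by rw [hκ, div_div_cancel₀ hM.ne']
  have hS := hstep κ hκ1 T (hT ▸ Nat.le_ceil _)
  have hT' : T ≤ 4 * (√κ * (1 + Real.log κ)) + 1 := hT ▸ (Nat.ceil_lt_add_one (by positivity)).le
  obtain ⟨N, Q, hN, hQ, hbox⟩ := hinit κ hκ1 hμL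
  refine ⟨N, Q, hN.trans (by gcongr; linarith), hQ.trans (by gcongr; linarith), fun m n f g hA hΦ =>
    ⟨fun x => (hA.hasGradientAt_Phi hμ hLf1.le hLg2.le x).differentiableAt, fun s hs K hK =>
      ⟨hA.minGradLE_nboCG hS hΦ hs hK, fun hsD =>
        hA.minGradLE_nboCG_of_le hΦ hs (hsD.trans (le_abs_self D)) hS (by linarith) hK⟩, ?_, ?_⟩⟩
  · exact fun s hs hsD _ => hA.exists_minGradLE_and_costLE hΦ hs (hsD.trans (le_abs_self D)) hS ha
      hC₀.le hC.le hT' (N := 0) (Q := 0) (by rw [Nat.cast_zero]; positivity)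
      (by rw [Nat.cast_zero]; positivity) fun K => by
        have := cost_nboCG_le f g (a / κ ^ 3) T s K
        omega
  · exact fun s hsR huR => ⟨hbox m n f g hA s hsR huR, fun hsD _ =>
      hA.exists_minGradLE_and_costLE hΦ (hbox m n f g hA s hsR huR) (hsD.trans (le_abs_self D)) hS
        ha hC₀.le hC.le hT' hN hQ fun K => by
          have := cost_fullNboCG_le f g β N Q (a / κ ^ 3) T s K
          omega⟩
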